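/- **Conventions.** $2^\omega$ is the Cantor group with coordinatewise addition mod 2; ${}^n2$ is the set of binary sequences of length $n$; $\trianglelefteq$ means "initial segment of"; $u^{\langle2\rangle}=\{(x,y)\in u\times u:x\ne y\}$. A tree is a set $T\subseteq{}^{<\omega}2$ closed under initial segments, and $\lim(T)$ is the set of its infinite branches. In forcing, larger conditions are stronger. Fix $2\le\iota<\omega$, $\bar c=\langle c_m:m<\omega\rangle\subseteq\omega$, trees $\bar T=\langle T_m:m<\omega\rangle$ without maximal nodes, $B=\bigcup_m\lim(T_m)$, and an ordinal $0<\varepsilon<\omega_1$. **YZR systems.** A $\mathcal{YZR}(\varepsilon)$-system is $s=(X,\bar r,\bar\jmath,\bar k)$ with $X$ a nonempty set of ordinals and $\bar r,\bar\jmath,\bar k$ functions on the nonempty finite subsets of $X$, with values in $\varepsilon+1,\omega,\omega$ respectively, such that: $\bar r(u)\ge\bar r(w)$ if $\emptyset\neq u\subseteq w$; $\bar r(\{a\})>0$; and if $w=\{a_0<\dots<a_{n-1}\}$, $n\geq 1$, then $\bar k(w)<n$ and there is no $b\in X\setminus w$ with $|w\cap b|=\bar k(w)$, $\bar\jmath((w\setminus\{a_{\bar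 k(w)}\})\cup\{b\})=\bar\jmath(w)$ and $\bar r(w\cup\{b\})=\bar r(w)$. A quasi-embedding of $q$ in $s$ is an increasing injection $\varphi:X^q\to X^s$ such that for nonempty finite $v\subseteq X^q$, $\bar r^s(\varphi[v])=\bar r^q(v)$, $\bar k^s(\varphi[v])=\bar k^q(v)$ and, if $\bar r^q(v)>0$, $\bar\jmath^s(\varphi[v])=\bar\jmath^q(v)$; a map $\varphi:w\to X^s$ with $w\subseteq X^s$ is a quasi-embedding if it is one of $s\restriction w$ in $s$. $S$ is cute if $X^S=\omega$ and for every finite $\mathcal{YZR}(\varepsilon)$-system $q$ and every $M<\omega$ there is a quasi-embedding of $q$ in $S$ with range in $[M,\omega)$. Fix a cute $S=(\omega,\bar r,\bar\jmath,\bar k)$. **The family $\mathbf M$.** $\mathbf M=\mathbf M_{\bar T,\iota}$ consists of the tuples $\mathbf m=(\ell,u,\bar h,\bar g)$ with $0<\ell<\omega$, $u\subseteq{}^\ell2$, $|u|\ge2$, $h_i:u^{\langle2\rangle}\to\omega$ and $g_i:u^{\langle2\rangle}\to{}^\ell2$ ($i<\iota$) such that, for all $(\eta,\nu)\in u^{\langle2\rangle}$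 and $i<\iota$: $g_i(\eta,\nu)\in T_{h_i(\eta,\nu)}$; $\eta+g_i(\eta,\nu)=\nu+g_i(\nu,\eta)$; the sequence $\langle g_i(\eta,\nu),g_i(\nu,\eta):i<\iota\rangle$ has no repetitions; and there are $F(\eta)\in2^\omega$ extending $\eta$ ($\eta\in u$) and $G_i(\eta,\nu)\in\lim(T_{h_i(\eta,\nu)})$ extending $g_i(\eta,\nu)$ with $F(\eta)+G_i(\eta,\nu)=F(\nu)+G_i(\nu,\eta)$ for all $(\eta,\nu)\in u^{\langle 2\rangle}$, $i<\iota$. For $\rho\in{}^\ell2$, $\mathbf m+\rho$ is obtained by replacing each $\eta\in u$ by $\eta+\rho$ and keeping the values of $h_i,g_i$. Write $\mathbf m\sqsubseteq^*\mathbf n$ if $\ell_{\mathbf m}\le\ell_{\mathbf n}$, $u_{\mathbf m}=\{\eta\restriction\ell_{\mathbf m}:\eta\in u_{\mathbf n}\}$, and whenever $\eta,\nu\in u_{\mathbf n}$ and $\eta'=\eta\restriction\ell_{\mathbf m}\ne\nu'=\nu\restriction\ell_{\mathbf m}$: $\{\{g^{\mathbf m}_i(\eta',\nu'),g^{\mathbf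 m}_i(\nu',\eta')\}:i<\iota\}=\{\{g^{\mathbf n}_i(\eta,\nu)\restriction\ell_{\mathbf m},g^{\mathbf n}_i(\nu,\eta)\restriction\ell_{\mathbf m}\}:i<\iota\}$, and for $i,j<\iota$, $g_i^{\mathbf m}(\eta',\nu')=g_j^{\mathbf n}(\eta,\nu)\restriction\ell_{\mathbf m}$ implies $h_i^{\mathbf m}(\eta',\nu')=h_j^{\mathbf n}(\eta,\nu)$, and $g_i^{\mathbf m}(\eta',\nu')=g_j^{\mathbf n}(\nu,\eta)\restriction\ell_{\mathbf m}$ implies $h_i^{\mathbf m}(\eta',\nu')=h_j^{\mathbf n}(\nu,\eta)$. Write $\mathbf m\doteqdot\mathbf n$ if $\ell_{\mathbf m}=\ell_{\mathbf n}$ and $\mathbf m\sqsubseteq^*\mathbf n$. **Bricks.** An $(S,\iota,\bar T,\bar c)$-brick is $\mathfrak b=(w,n,\bar\eta,\bar h,\bar g,\mathcal M)$ such that: $w\in[\omega]^{<\omega}$, $|w|\ge3$, $0<n<\omega$; $\langle\eta_a:a\in w\rangle$ is linearly independent in ${}^n2$ over $\mathbb Z_2$; $h_i:w^{\langle2\rangle}\to\omega$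 with $c_{h_i(a,b)}\le n$ and $g_i:w^{\langle2\rangle}\to{}^n2$ ($i<\iota$); $(n,\{\eta_a:a\in w\},\bar h^*,\bar g^*)\in\mathbf M$, where $h_i^*(\eta_a,\eta_b)=h_i(a,b)$ and $g_i^*(\eta_a,\eta_b)=g_i(a,b)$; $\mathcal M$ is the set of all $\mathbf m=\mathbf m(\ell,w_*)\in\mathbf M$ for which $0<\ell_{\mathbf m}=\ell\le n$, $w_*\subseteq w$, $|w_*|\ge3$, $c_{h_i(a,b)}\le\ell$ for $(a,b)\in w_*^{\langle2\rangle}$ and $i<\iota$, the $\eta_a\restriction\ell$ ($a\in w_*$) are distinct and form $u_{\mathbf m}$, $h^{\mathbf m}_i(\eta_a\restriction\ell,\eta_b\restriction\ell)=h_i(a,b)$ and $g_i^{\mathbf m}(\eta_a\restriction\ell,\eta_b\restriction\ell)=g_i(a,b)\restriction\ell$; if $\mathbf m(\ell,w_0),\mathbf m(\ell,w_1)\in\mathcal M$ and $\mathbf m(\ell,w_0)\doteqdot\mathbf m(\ell,w_1)+\rho$ with $\rho\in{}^\ell2$, then the order isomorphism $\pi:w_0\to w_1$ is a quasi-embedding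 and $(\eta_a\restriction\ell)+\rho=\eta_{\pi(a)}\restriction\ell$ for $a\in w_0$; and if $\mathbf m(\ell,w_*)\in\mathcal M$, $a\in w_*$, $|a\cap w_*|=\bar k(w_*)$, $\bar r(w_*)=0$ and $\mathbf m(\ell,w_*)\sqsubseteq^*\mathbf n\in\mathcal M$, then exactly one $\nu\in u_{\mathbf n}$ extends $\eta_a\restriction\ell$. Put $\mathfrak b_0\Subset\mathfrak b_1$ if $w^{\mathfrak b_0}\subseteq w^{\mathfrak b_1}$, $n^{\mathfrak b_0}\le n^{\mathfrak b_1}$, and on $w^{\mathfrak b_0}$ we have $\eta_a^{\mathfrak b_0}\trianglelefteq\eta_a^{\mathfrak b_1}$, $h_i^{\mathfrak b_0}(a,b)=h_i^{\mathfrak b_1}(a,b)$ and $g_i^{\mathfrak b_0}(a,b)\trianglelefteq g_i^{\mathfrak b_1}(a,b)$. $\mathfrak b\restriction w$ denotes restriction to $w\subseteq w^{\mathfrak b}$, $|w|\ge 3$ (with the same $n$), and $\varphi(\mathfrak b)$ the copy of $\mathfrak b$ along a quasi-embedding $\varphi:w^{\mathfrak b}\to\omega$. **Controlled amalgamation.**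 $\bar T$ has the $(\bar c,S)$-controlled amalgamation property if there are bricks $\mathfrak b_n$ ($n<\omega$) with $\mathfrak b_n\Subset\mathfrak b_{n+1}$, $\bigcup_nw^{\mathfrak b_n}=\omega$, $n^{\mathfrak b_n}\to\infty$, such that: (i) if $u\subseteq w\subseteq w^{\mathfrak b_n}$, $|w|\ge3$, $\bar k(v\cup\{\delta\})\ne|\delta\cap v|$ whenever $v\subseteq u$, $\delta\in w\setminus u$ and $\bar r(v\cup\{\delta\})=0$, and $\pi_0,\pi_1:w\to\omega$ are quasi-embeddings that agree on $u$ with $\pi_0[w\setminus u]\cap\pi_1[w\setminus u]=\emptyset$, then for some $K$ there is a quasi-embedding $\pi:\mathrm{rng}(\pi_0)\cup\mathrm{rng}(\pi_1)\to w^{\mathfrak b_K}$ with $(\pi\circ\pi_j)(\mathfrak b_n\restriction w)\Subset\mathfrak b_K\restriction(\pi\circ\pi_j[w])$ for $j=0,1$; (ii) if $w\subseteq w^{\mathfrak b_n}$, $|w|\ge3$, $\pi_0:w\to\omega$ is a quasi-embedding and $\mathrm{rng}(\pi_0)\subseteq u\in[\omega]^{<\omega}$, then for some $K$ there is a quasi-embedding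 $\pi:u\to w^{\mathfrak b_K}$ with $(\pi\circ\pi_0)(\mathfrak b_n\restriction w)\Subset\mathfrak b_K\restriction(\pi\circ\pi_0[w])$. **$\mathrm{NPr}^\varepsilon(\lambda)$.** For a model $\mathbb M$ with universe $\lambda$ in a countable vocabulary and finite nonempty $w=\{\alpha_0,\dots,\alpha_n\}\subseteq\lambda$ (of size $n+1$), define $\mathrm{rk}(w,\mathbb M)\ge\delta$ by induction on $\delta$: $\mathrm{rk}(w,\mathbb{M})\ge0$ iff for every quantifier-free $\varphi$ and $k\le n$ with $\mathbb M\models\varphi[\alpha_0,\dots,\alpha_n]$, the set of $\alpha<\lambda$ such that $\mathbb M\models\varphi[\alpha_0,\dots,\alpha_{k-1},\alpha,\alpha_{k+1},\dots,\alpha_n]$ is uncountable; $\mathrm{rk}(w,\mathbb{M})\ge\delta+1$ iff for all such $\varphi,k$ there is $\alpha\in\lambda\setminus w$ with $\mathrm{rk}(w\cup\{\alpha\},\mathbb{M})\ge\delta$ and $\mathbb M\models\varphi[\alpha_0,\dots,\alpha_{k-1},\alpha,\alpha_{k+1},\dots,\alpha_n]$; at limit $\delta$, iff $\mathrm{rk}(w,\mathbb{M})\ge\gamma$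 for all $\gamma<\delta$. Then $\mathrm{rk}(w,\mathbb{M})$ is the largest $\delta$ with $\mathrm{rk}(w,\mathbb{M})\ge\delta$ ($-1$ if there is none, $\infty$ if $\mathrm{rk}(w,\mathbb{M})\ge\delta$ for all $\delta$). $\mathrm{NPr}^\varepsilon(\lambda)$ says that for some such $\mathbb M$, $1+\mathrm{rk}(w,\mathbb M)\le\varepsilon$ for all finite nonempty $w\subseteq\lambda$. **Theorem.** Assume that $\bar T$ has the $(\bar c,S)$-controlled amalgamation property, where $S$ is a cute $\mathcal{YZR}(\varepsilon)$-system, and let $\lambda$ be an infinite cardinal such that $\mathrm{NPr}^\varepsilon(\lambda)$ holds. Then there is a ccc (indeed Knaster) forcing notion $\mathbb P$ of size $\lambda$ such that $$\Vdash_{\mathbb P}\text{``there is a sequence }\langle\eta_\alpha:\alpha<\lambda\rangle\text{ of distinct elements of }2^\omega\text{ such that }|(\eta_\alpha+B)\cap(\eta_\beta+B)|\ge2\iota\text{ for all }\alpha,\beta<\lambda\text{''},$$ where $B=\bigcup_m\lim(T_m)$ is evaluated in the extension. -/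

import Mathlib

universe u

open scoped Cardinal Ordinal

namespace YZRForcing

/-! ### Binary sequences, trees, the Cantor group -/

/-- `ⁿ2`, a vector space over `ℤ/2` under coordinatewise addition. -/
abbrev BSeq (n : ℕ) : Type := Fin n → ZMod 2

/-- The Cantor group `2^ω` with coordinatewise addition modulo 2. -/
abbrev Cantor : Type := ℕ → ZMod 2

/-- The restriction `s ↾ l` of a finite sequence; only used for `l ≤ n`
(the value `0` beyond the length of `s` is then never reached). -/
def restr {n : ℕ} (l : ℕ) (s : BSeq n) : BSeq l :=
  fun k => if h : (k : ℕ) < n then s ⟨k, h⟩ else 0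

/-- The restriction `x ↾ l` of an infinite sequence. -/
def cut (l : ℕ) (x : Cantor) : BSeq l := fun k => x k

/-- `s ⊴ t`: `s` is an initial segment of `t`. -/
def InitSeg {m n : ℕ} (s : BSeq m) (t : BSeq n) : Prop := m ≤ n ∧ restr m t = s

/-- A set of finite binary sequences, given level by level: `T n` is `T ∩ ⁿ2`. -/
abbrev NodeSet : Type := (n : ℕ) → Set (BSeq n)

/-- `T` is closed under initial segments. -/
def IsTree (T : NodeSet) : Prop :=
  ∀ ⦃m n : ℕ⦄ (s : BSeq m) (t : BSeq n), InitSeg s t → t ∈ T n → s ∈ T m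

/-- Every node has a proper extension in `T`. -/
def NoMaximalNodes (T : NodeSet) : Prop :=
  ∀ (n : ℕ) (s : BSeq n), s ∈ T n → ∃ (m : ℕ) (t : BSeq m), n < m ∧ t ∈ T m ∧ InitSeg s t

/-- `lim T`, the set of infinite branches. -/
def branches (T : NodeSet) : Set Cantor := {x | ∀ n, cut n x ∈ T n}

/-! ### The family `M_{T,ι}` -/

/-- A tuple `(l, u, h, g)`, with the level `l` as an index.  The functions `h i` and `g i` are
only meaningful at pairs of distinct elements of `u`; no definition below looks at other values. -/
structure MTuple (ι l : ℕ) where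
  u : Finset (BSeq l)
  h : Fin ι → BSeq l → BSeq l → ℕ
  g : Fin ι → BSeq l → BSeq l → BSeq l

namespace MTuple

variable {ι l l' : ℕ}

/-- Membership in `M_{T,ι}`. -/
structure Mem (T : ℕ → NodeSet) (m : MTuple ι l) : Prop where
  l_pos : 0 < l
  two_le : 2 ≤ m.u.card
  g_mem : ∀ x ∈ m.u, ∀ y ∈ m.u, x ≠ y → ∀ i, m.g i x y ∈ T (m.h i x y) l
  add_eq : ∀ x ∈ m.u, ∀ y ∈ m.u, x ≠ y → ∀ i, x + m.g i x y = y + m.g i y x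
  no_rep : ∀ x ∈ m.u, ∀ y ∈ m.u, x ≠ y →
    Function.Injective (Sum.elim (fun i : Fin ι => m.g i x y) (fun i : Fin ι => m.g i y x))
  branch : ∃ (F : BSeq l → Cantor) (G : Fin ι → BSeq l → BSeq l → Cantor),
    (∀ x ∈ m.u, cut l (F x) = x) ∧
    ∀ x ∈ m.u, ∀ y ∈ m.u, x ≠ y → ∀ i,
      cut l (G i x y) = m.g i x y ∧
      G i x y ∈ branches (T (m.h i x y)) ∧
      F x + G i x y = F y + G i y x

/-- The translation `m + ρ`. -/
def translate (m : MTuple ι l) (ρ : BSeq l) : MTuple ι l where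
  u := m.u.image (fun x => x + ρ)
  h := fun i x y => m.h i (x - ρ) (y - ρ)
  g := fun i x y => m.g i (x - ρ) (y - ρ)

/-- `m ≐ m'`: the tuples are essentially the same. -/
def EssSame (m m' : MTuple ι l) : Prop :=
  m.u = m'.u ∧
  ∀ x ∈ m.u, ∀ y ∈ m.u, x ≠ y →
    Set.range (fun i => s(m.g i x y, m.g i y x)) =
      Set.range (fun i => s(m'.g i x y, m'.g i y x)) ∧
    ∀ i j,
      (m.g i x y = m'.g j x y → m.h i x y = m'.h j x y) ∧
      (m.g i x y = m'.g j y x → m.h i x y = m'.h j y x)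

/-- `m ⊑* m'`: the tuple `m'` essentially extends `m`. -/
def EssExt (m : MTuple ι l) (m' : MTuple ι l') : Prop :=
  l ≤ l' ∧ m.u = m'.u.image (restr l) ∧
  ∀ x ∈ m'.u, ∀ y ∈ m'.u, restr l x ≠ restr l y →
    Set.range (fun i => s(m.g i (restr l x) (restr l y), m.g i (restr l y) (restr l x))) =
      Set.range (fun i => s(restr l (m'.g i x y), restr l (m'.g i y x))) ∧
    ∀ i j,
      (m.g i (restr l x) (restr l y) = restr l (m'.g j x y) →
        m.h i (restr l x) (restr l y) = m'.h j x y) ∧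
      (m.g i (restr l x) (restr l y) = restr l (m'.g j y x) →
        m.h i (restr l x) (restr l y) = m'.h j y x)

end MTuple

/-! ### YZR systems -/

/-- The position of `a` relative to the finite set `w`: the number of elements of `w` below `a`
(for ordinals this is `|w ∩ a|`). -/
def pos {X : Type*} [LinearOrder X] (w : Finset X) (a : X) : ℕ := (w.filter (· < a)).card

/-- A `YZR(ε)`-system on a nonempty well-ordered set `X` (in place of a nonempty set of ordinals).
The values of `r`, `j`, `k` at the empty set are irrelevant. -/
structure YZRSystem (X : Type*) [LinearOrder X] [WellFoundedLT X] (ε : Ordinal.{u}) where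
  nonempty : Nonempty X
  r : Finset X → Ordinal.{u}
  j : Finset X → ℕ
  k : Finset X → ℕ
  r_le : ∀ w, w.Nonempty → r w ≤ ε
  r_anti : ∀ v w, v.Nonempty → v ⊆ w → r w ≤ r v
  r_singleton : ∀ a, 0 < r {a}
  k_lt : ∀ w, w.Nonempty → k w < w.card
  no_twin : ∀ w, ∀ a ∈ w, pos w a = k w →
    ¬ ∃ b, b ∉ w ∧ pos w b = k w ∧ j (insert b (w.erase a)) = j w ∧ r (insert b w) = r w

/-- `φ` restricted to `w ⊆ X` is a quasi-embedding of the restricted system `q ↾ w` into `s`. -/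
def IsQuasiEmbOn {X Y : Type*} [LinearOrder X] [WellFoundedLT X] [LinearOrder Y] [WellFoundedLT Y]
    {ε : Ordinal.{u}} (q : YZRSystem X ε) (s : YZRSystem Y ε) (w : Set X) (φ : X → Y) : Prop :=
  StrictMonoOn φ w ∧
  ∀ v : Finset X, v.Nonempty → (v : Set X) ⊆ w →
    s.r (v.image φ) = q.r v ∧ s.k (v.image φ) = q.k v ∧
    (0 < q.r v → s.j (v.image φ) = q.j v)

/-- A system on `ω` is cute if every finite system quasi-embeds into it above any given bound. -/
def IsCute {ε : Ordinal.{u}} (S : YZRSystem ℕ ε) : Prop :=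
  ∀ (X : Type u) [LinearOrder X] [WellFoundedLT X] [Finite X] (q : YZRSystem X ε) (M : ℕ),
    ∃ φ : X → ℕ, IsQuasiEmbOn q S Set.univ φ ∧ ∀ a, M ≤ φ a

/-! ### Bricks and the controlled amalgamation property -/

/-- The data `(w, n, η, h, g)` of a brick.  The values of `η` off `w`, and of `h i`, `g i` off the
pairs of distinct elements of `w`, are irrelevant.  The last component of a brick is determined by
the others and is the family `BrickData.InFamily` below. -/
structure BrickData (ι : ℕ) where
  w : Finset ℕ
  n : ℕ
  η : ℕ → BSeq n
  h : Fin ι → ℕ → ℕ → ℕ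
  g : Fin ι → ℕ → ℕ → BSeq n

namespace BrickData

variable {ι l : ℕ}

/-- `m` is the tuple `m(l, w₀)` of the brick, and it belongs to the family `ℳ` of the brick. -/
structure IsApprox (b : BrickData ι) (T : ℕ → NodeSet) (c : ℕ → ℕ) (w₀ : Finset ℕ)
    (m : MTuple ι l) : Prop where
  mem : m.Mem T
  subset : w₀ ⊆ b.w
  three_le : 3 ≤ w₀.card
  le_n : l ≤ b.n
  c_le : ∀ a ∈ w₀, ∀ a' ∈ w₀, a ≠ a' → ∀ i, c (b.h i a a') ≤ l
  u_eq : m.u = w₀.image (fun a => restr l (b.η a))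
  distinct : ∀ a ∈ w₀, ∀ a' ∈ w₀, a ≠ a' → restr l (b.η a) ≠ restr l (b.η a')
  h_eq : ∀ a ∈ w₀, ∀ a' ∈ w₀, a ≠ a' → ∀ i,
    m.h i (restr l (b.η a)) (restr l (b.η a')) = b.h i a a'
  g_eq : ∀ a ∈ w₀, ∀ a' ∈ w₀, a ≠ a' → ∀ i,
    m.g i (restr l (b.η a)) (restr l (b.η a')) = restr l (b.g i a a')

/-- The family `ℳ` of the brick. -/
def InFamily (b : BrickData ι) (T : ℕ → NodeSet) (c : ℕ → ℕ) (m : MTuple ι l) : Prop :=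
  ∃ w₀, b.IsApprox T c w₀ m

/-- `b` is an `(S, ι, T, c)`-brick. -/
structure IsBrick {ε : Ordinal.{u}} (b : BrickData ι) (S : YZRSystem ℕ ε) (T : ℕ → NodeSet)
    (c : ℕ → ℕ) : Prop where
  three_le : 3 ≤ b.w.card
  n_pos : 0 < b.n
  lin_indep : LinearIndependent (ZMod 2) (fun a : {a // a ∈ b.w} => b.η a)
  c_le : ∀ a ∈ b.w, ∀ a' ∈ b.w, a ≠ a' → ∀ i, c (b.h i a a') ≤ b.n
  top_mem : ∃ m : MTuple ι b.n, m.Mem T ∧ m.u = b.w.image b.η ∧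
    ∀ a ∈ b.w, ∀ a' ∈ b.w, a ≠ a' → ∀ i,
      m.h i (b.η a) (b.η a') = b.h i a a' ∧ m.g i (b.η a) (b.η a') = b.g i a a'
  rigid : ∀ (l : ℕ) (w₀ w₁ : Finset ℕ) (m₀ m₁ : MTuple ι l) (ρ : BSeq l),
    b.IsApprox T c w₀ m₀ → b.IsApprox T c w₁ m₁ → m₀.EssSame (m₁.translate ρ) →
    ∃ π : ℕ → ℕ, w₀.image π = w₁ ∧ IsQuasiEmbOn S S (w₀ : Set ℕ) π ∧
      ∀ a ∈ w₀, restr l (b.η a) + ρ = restr l (b.η (π a))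
  no_split : ∀ (l l' : ℕ) (w₀ : Finset ℕ) (m : MTuple ι l) (m' : MTuple ι l') (a : ℕ),
    b.IsApprox T c w₀ m → a ∈ w₀ → pos w₀ a = S.k w₀ → S.r w₀ = 0 →
    b.InFamily T c m' → m.EssExt m' →
    (m'.u.filter (fun x => restr l x = restr l (b.η a))).card = 1

/-- `φ(b ↾ w₀) ⋐ b' ↾ φ[w₀]`, written out: `b'` extends the copy along `φ` of the restriction of `b`
to `w₀`. -/
def CopyLE (b : BrickData ι) (w₀ : Finset ℕ) (φ : ℕ → ℕ) (b' : BrickData ι) : Prop :=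
  w₀.image φ ⊆ b'.w ∧ b.n ≤ b'.n ∧
  (∀ a ∈ w₀, InitSeg (b.η a) (b'.η (φ a))) ∧
  ∀ a ∈ w₀, ∀ a' ∈ w₀, a ≠ a' → ∀ i,
    b'.h i (φ a) (φ a') = b.h i a a' ∧ InitSeg (b.g i a a') (b'.g i (φ a) (φ a'))

/-- The relation `b ⋐ b'` between bricks. -/
def BrickLE (b b' : BrickData ι) : Prop := b.CopyLE b.w id b'

end BrickData

/-- `T` has the `(c, S)`-controlled amalgamation property (for `ι`). -/
def ControlledAmalgamation {ε : Ordinal.{u}} (S : YZRSystem ℕ ε) (ι : ℕ) (T : ℕ → NodeSet)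
    (c : ℕ → ℕ) : Prop :=
  ∃ b : ℕ → BrickData ι,
    (∀ n, (b n).IsBrick S T c) ∧
    (∀ n, (b n).BrickLE (b (n + 1))) ∧
    (∀ a : ℕ, ∃ n, a ∈ (b n).w) ∧
    Filter.Tendsto (fun n => (b n).n) Filter.atTop Filter.atTop ∧
    (∀ (n : ℕ) (v₀ w : Finset ℕ) (π₀ π₁ : ℕ → ℕ),
      v₀ ⊆ w → w ⊆ (b n).w → 3 ≤ w.card →
      (∀ v ⊆ v₀, ∀ d ∈ w \ v₀, S.r (insert d v) = 0 → S.k (insert d v) ≠ pos v d) →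
      IsQuasiEmbOn S S (w : Set ℕ) π₀ → IsQuasiEmbOn S S (w : Set ℕ) π₁ →
      (∀ a ∈ v₀, π₀ a = π₁ a) → Disjoint ((w \ v₀).image π₀) ((w \ v₀).image π₁) →
      ∃ (K : ℕ) (π : ℕ → ℕ),
        IsQuasiEmbOn S S ((w.image π₀ ∪ w.image π₁ : Finset ℕ) : Set ℕ) π ∧
        (w.image π₀ ∪ w.image π₁).image π ⊆ (b K).w ∧
        (b n).CopyLE w (π ∘ π₀) (b K) ∧ (b n).CopyLE w (π ∘ π₁) (b K)) ∧
    (∀ (n : ℕ) (w v : Finset ℕ) (π₀ : ℕ → ℕ),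
      w ⊆ (b n).w → 3 ≤ w.card → IsQuasiEmbOn S S (w : Set ℕ) π₀ → w.image π₀ ⊆ v →
      ∃ (K : ℕ) (π : ℕ → ℕ),
        IsQuasiEmbOn S S (v : Set ℕ) π ∧ v.image π ⊆ (b K).w ∧ (b n).CopyLE w (π ∘ π₀) (b K))

/-! ### The splitting rank and `NPr` -/

section Rank

open FirstOrder

variable (L : FirstOrder.Language.{0, 0}) {Λ : Type u} [DecidableEq Λ] [L.Structure Λ]

/-- `rk(w, 𝕄) ≥ δ`, by induction on `δ`.  Formulas about the elements of `w` have the elements of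
`w` as their free variables. -/
noncomputable def RankGE (δ : Ordinal.{u}) : Finset Λ → Prop :=
  Ordinal.limitRecOn δ
    (fun w => ∀ φ : L.Formula {a // a ∈ w}, FirstOrder.Language.BoundedFormula.IsQF φ →
      φ.Realize (fun a => (a : Λ)) → ∀ k : {a // a ∈ w},
        ¬ {α : Λ | φ.Realize (Function.update (fun a => (a : Λ)) k α)}.Countable)
    (fun _ ih w => ∀ φ : L.Formula {a // a ∈ w}, FirstOrder.Language.BoundedFormula.IsQF φ →
      φ.Realize (fun a => (a : Λ)) → ∀ k : {a // a ∈ w},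
        ∃ α : Λ, α ∉ w ∧ ih (insert α w) ∧
          φ.Realize (Function.update (fun a => (a : Λ)) k α))
    (fun o _ ih w => ∀ (γ : Ordinal.{u}) (hγ : γ < o), ih γ hγ w)

end Rank

/-- `NPr^ε(κ)`: there is a model with universe `κ` in a countable vocabulary such that
`1 + rk(w) ≤ ε` for all nonempty finite `w`.  As `rk(w)` is the largest `δ` with `rk(w) ≥ δ`
(`-1` if there is none, `∞` if all `δ` qualify), this says that `1 + δ ≤ ε` for all such `δ`. -/
def NPr (ε : Ordinal.{u}) (κ : Cardinal.{u}) : Prop :=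
  ∃ (L : FirstOrder.Language.{0, 0}) (_ : Countable L.Symbols) (_ : L.Structure κ.ord.ToType),
    ∀ w : Finset κ.ord.ToType, w.Nonempty → ∀ δ : Ordinal.{u}, RankGE L δ w → 1 + δ ≤ ε

/-! ### Forcing notions; larger conditions are stronger -/

/-- Compatible conditions have a common extension. -/
def Compat {P : Type u} [PartialOrder P] (p q : P) : Prop := ∃ r, p ≤ r ∧ q ≤ r

/-- Every set of pairwise incompatible conditions is countable. -/
def IsCCC (P : Type u) [PartialOrder P] : Prop :=
  ∀ A : Set P, A.Pairwise (fun p q => ¬ Compat p q) → A.Countable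

/-- Every uncountable set of conditions has an uncountable subset of pairwise compatible ones. -/
def IsKnaster (P : Type u) [PartialOrder P] : Prop :=
  ∀ A : Set P, ¬ A.Countable → ∃ B ⊆ A, ¬ B.Countable ∧ B.Pairwise Compat

/-! ### Names and the forcing relation -/

/-- `P`-names: sets of pairs (name, condition). -/
inductive PName (P : Type u) : Type (u + 1)
  | mk (I : Type u) (name : I → PName P) (cond : I → P) : PName P

/-- A statement of the forcing language, given by the conditions that force it. -/
abbrev FProp (P : Type u) : Type u := P → Prop

section Names

variable {P : Type u} [PartialOrder P]

/-- `p ⊩ σ = τ`: for every `(π, s) ∈ σ`, each `q ≥ p, s` forces `π ∈ τ` (that is, the conditions `r`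
such that `r ≥ t` and `r ⊩ π = π'` for some `(π', t) ∈ τ` are dense above `q`), and vice versa. -/
def fEq : PName P → PName P → FProp P
  | .mk _ A c, .mk _ B d => fun p =>
    (∀ i, ∀ q, p ≤ q → c i ≤ q → ∀ q', q ≤ q' → ∃ r, q' ≤ r ∧ ∃ j, d j ≤ r ∧ fEq (A i) (B j) r) ∧
    (∀ j, ∀ q, p ≤ q → d j ≤ q → ∀ q', q ≤ q' → ∃ r, q' ≤ r ∧ ∃ i, c i ≤ r ∧ fEq (A i) (B j) r)

/-- `p ⊩ σ ∈ τ`. -/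
def fMem (σ : PName P) : PName P → FProp P
  | .mk _ B d => fun p => ∀ q, p ≤ q → ∃ r, q ≤ r ∧ ∃ j, d j ≤ r ∧ fEq σ (B j) r

/-- Negation. -/
def fNot (φ : FProp P) : FProp P := fun p => ∀ q, p ≤ q → ¬ φ q

/-- Conjunction. -/
def fAnd (φ ψ : FProp P) : FProp P := fun p => φ p ∧ ψ p

/-- Disjunction. -/
def fOr (φ ψ : FProp P) : FProp P := fun p => ∀ q, p ≤ q → ∃ r, q ≤ r ∧ (φ r ∨ ψ r)

/-- Implication. -/
def fImp (φ ψ : FProp P) : FProp P := fun p => ∀ q, p ≤ q → φ q → ψ q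

/-- Universal quantifier.  With `A` the class of names this is the quantifier `∀ x` over the
extension; with `A` a set `a` of the ground model it is the bounded quantifier `∀ x ∈ ǎ`. -/
def fAll {A : Type*} (φ : A → FProp P) : FProp P := fun p => ∀ a, φ a p

/-- Existential quantifier, over names or over a set of the ground model, as for `fAll`. -/
def fEx {A : Type*} (φ : A → FProp P) : FProp P := fun p => ∀ q, p ≤ q → ∃ r, q ≤ r ∧ ∃ a, φ a r

/-- `φ` is forced by all conditions. -/
def Forced (φ : FProp P) : Prop := ∀ p, φ p

/-- The name for the unordered pair `{σ, τ}`. -/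
def upName (σ τ : PName P) : PName P :=
  .mk (ULift.{u} Bool × P) (fun x => if x.1.down then σ else τ) (fun x => x.2)

/-- The name for the (Kuratowski) ordered pair `(σ, τ)`. -/
def opName (σ τ : PName P) : PName P := upName (upName σ σ) (upName σ τ)

/-- The canonical name of the (von Neumann) ordinal `α`: all pairs `(β̌, p)` with `β < α`, `p ∈ P`. -/
noncomputable def ordName (α : Ordinal.{u}) : PName P :=
  .mk (α.ToType × P) (fun x => ordName x.1.toOrd.1) (fun x => x.2)
termination_by α
decreasing_by exact x.1.toOrd.2

/-- `f` is a function with domain `{dom a : a ∈ A}`, all of whose values satisfy `φ`. -/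
def fIsFun {A : Type*} (dom : A → PName P) (φ : PName P → FProp P) (f : PName P) : FProp P :=
  fAnd (fAll fun z : PName P => fImp (fMem z f)
      (fEx fun a : A => fEx fun x : PName P => fAnd (φ x) (fEq z (opName (dom a) x))))
    (fAnd (fAll fun a : A => fEx fun x : PName P => fMem (opName (dom a) x) f)
      (fAll fun a : A => fAll fun x : PName P => fAll fun y : PName P =>
        fImp (fAnd (fMem (opName (dom a) x) f) (fMem (opName (dom a) y) f)) (fEq x y)))

/-- `x ∈ 2^ω`: `x` is a function from `ω` to `{0, 1}`. -/
noncomputable def fCantor (x : PName P) : FProp P :=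
  fIsFun (fun n : ℕ => ordName (n : Ordinal.{u}))
    (fun y => fOr (fEq y (ordName 0)) (fEq y (ordName 1))) x

/-- `x(n) = i`. -/
noncomputable def fVal (x : PName P) (n : ℕ) (i : ZMod 2) : FProp P :=
  fMem (opName (ordName (n : Ordinal.{u})) (ordName (i.val : Ordinal.{u}))) x

/-- `z = x + y`, for elements of the Cantor group. -/
noncomputable def fAdd (x y z : PName P) : FProp P :=
  fAll fun n : ℕ => fAll fun i : ZMod 2 => fAll fun j : ZMod 2 =>
    fImp (fAnd (fVal x n i) (fVal y n j)) (fVal z n (i + j))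

/-- `x ∈ lim T`, evaluated in the extension: `x ∈ 2^ω` and for every `n`, `x ↾ n` is some `s ∈ T`. -/
noncomputable def fBranch (T : NodeSet) (x : PName P) : FProp P :=
  fAnd (fCantor x)
    (fAll fun n : ℕ => fEx fun s : {s : BSeq n // s ∈ T n} => fAll fun k : Fin n => fVal x k (s.1 k))

/-- `x ∈ B`, where `B = ⋃ m, lim (T m)`, evaluated in the extension. -/
noncomputable def fB (T : ℕ → NodeSet) (x : PName P) : FProp P :=
  fEx fun m : ℕ => fBranch (T m) x

/-- `z ∈ x + B`. -/
noncomputable def fTranslate (T : ℕ → NodeSet) (x z : PName P) : FProp P :=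
  fAnd (fCantor z) (fEx fun y : PName P => fAnd (fB T y) (fAdd x y z))

/-- `|(x + B) ∩ (y + B)| ≥ N`: there are `z₀, …, z_{N-1}` in the intersection, pairwise distinct. -/
noncomputable def fOverlap (T : ℕ → NodeSet) (N : ℕ) (x y : PName P) : FProp P :=
  fEx fun z : Fin N → PName P =>
    fAnd (fAll fun i => fAnd (fTranslate T x (z i)) (fTranslate T y (z i)))
      (fAll fun ij : {ij : Fin N × Fin N // ij.1 ≠ ij.2} => fNot (fEq (z ij.1.1) (z ij.1.2)))

/-- "There is a sequence `⟨η_α : α < κ⟩` of distinct elements of `2^ω` such that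
`|(η_α + B) ∩ (η_β + B)| ≥ N` for all `α, β < κ`." -/
noncomputable def fManyOverlaps (κ : Cardinal.{u}) (T : ℕ → NodeSet) (N : ℕ) : FProp P :=
  fEx fun f : PName P =>
    fAnd (fIsFun (fun α : Set.Iio κ.ord => ordName α.1) fCantor f)
      (fAll fun α : Set.Iio κ.ord => fAll fun β : Set.Iio κ.ord =>
        fAll fun x : PName P => fAll fun y : PName P =>
          fImp (fAnd (fMem (opName (ordName α.1) x) f) (fMem (opName (ordName β.1) y) f))
            (fAnd (fAll fun _ : PLift (α ≠ β) => fNot (fEq x y)) (fOverlap T N x y)))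

end Names

end YZRForcing

open YZRForcing

/-!
The forcing consists of finite approximations that are copies of parts of bricks, taken along
quasi-embeddings.

A model on `Λ = κ` witnessing `NPr ε κ` gives a `YZR(ε)`-system `s` on `Λ` (`nonempty_yzrSystem`):
`r w` is `1 + rk(w)`, and `k w`, `j w` record a place and a formula that keep `rk(w)` from being
larger.  When `rk(w) = -1` the formula has only countably many solutions at its place, and `j w`
also records which of them occurs in `w`; so there the element in position `k w` is determined by
`j w` and the rest of `w`.

A condition (`Condition`) is a finite `w ⊆ Λ` with a quasi-embedding `φ` of `s ↾ w` into `S` whose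
range lies in a brick `b N`; it promises that `η_a`, `g_i(a, a')` extend the sequences attached to
`φ a`, `φ a'` in that brick.  As `S` is cute, every finite part of `s` quasi-embeds into `S`, so the
extension clause of controlled amalgamation makes every element of `Λ` appear in a dense set of
conditions (`Condition.exists_le_mem`).

For the Knaster property (`Condition.isKnaster`), uncountably many conditions are thinned out so
that they are copies of the same part of the same brick with the same values of `j`, and form a
`Δ`-system (`exists_uncountable_root`).  Two of them can be amalgamated once the root satisfies the
requirement on `k` and `r` in the amalgamation clause.  If it failed for an element `d` outside the
root, the copies of `d` would be determined by the root and the common value of `j`, because a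
system has no twins (`Condition.eq_of_quasiEmb`); then they would coincide, against disjointness off
the root.

The generic filter yields reals `η_a` and branches `g_i(a, a') ∈ B` with
`η_a + g_i(a, a') = η_{a'} + g_i(a', a)`.  As the group has exponent `2`, also
`η_a + g_i(a', a) = η_{a'} + g_i(a, a')`, so these are `2ι` elements of `(η_a + B) ∩ (η_{a'} + B)`,
and they are distinct because the `g_i(a, a')`, `g_i(a', a)` are.  All these objects are names of
functions given by a monotone, consistent and densely defined family of values (`GenericReal`,
`graphName`), and `forced_fManyOverlaps` reduces the forced statement to facts about them.
-/

namespace YZRForcing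

/-! ### The forcing relation for equality and membership -/

section ForcingBasics

variable {P : Type u} [PartialOrder P]

theorem fEq_mk {I J : Type u} {A : I → PName P} {c : I → P} {B : J → PName P} {d : J → P} {p : P} :
    fEq (.mk I A c) (.mk J B d) p ↔
      (∀ i, ∀ q, p ≤ q → c i ≤ q → ∀ q', q ≤ q' →
        ∃ r, q' ≤ r ∧ ∃ j, d j ≤ r ∧ fEq (A i) (B j) r) ∧
      (∀ j, ∀ q, p ≤ q → d j ≤ q → ∀ q', q ≤ q' →
        ∃ r, q' ≤ r ∧ ∃ i, c i ≤ r ∧ fEq (A i) (B j) r) := by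
  rw [fEq]

theorem fMem_mk {σ : PName P} {J : Type u} {B : J → PName P} {d : J → P} {p : P} :
    fMem σ (.mk J B d) p ↔ ∀ q, p ≤ q → ∃ r, q ≤ r ∧ ∃ j, d j ≤ r ∧ fEq σ (B j) r := by
  rw [fMem]

theorem fEq_mono {σ τ : PName P} {p q : P} (hpq : p ≤ q) (h : fEq σ τ p) : fEq σ τ q := by
  cases σ; cases τ
  rw [fEq_mk] at h ⊢
  exact ⟨fun i r hr => h.1 i r (hpq.trans hr), fun j r hr => h.2 j r (hpq.trans hr)⟩

theorem fMem_mono {σ τ : PName P} {p q : P} (hpq : p ≤ q) (h : fMem σ τ p) : fMem σ τ q := by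
  cases τ
  rw [fMem_mk] at h ⊢
  exact fun r hr => h r (hpq.trans hr)

/-- What is forced densely above `p` is forced by `p`. -/
theorem fEq_of_dense {σ τ : PName P} {p : P} (h : ∀ q, p ≤ q → ∃ r, q ≤ r ∧ fEq σ τ r) :
    fEq σ τ p := by
  cases σ; cases τ
  rw [fEq_mk]
  constructor
  · intro i q hq hi q' hq'
    obtain ⟨r, hr, h'⟩ := h q' (hq.trans hq')
    obtain ⟨r', hr', x⟩ := (fEq_mk.1 h').1 i r le_rfl (hi.trans (hq'.trans hr)) r le_rfl
    exact ⟨r', hr.trans hr', x⟩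
  · intro j q hq hj q' hq'
    obtain ⟨r, hr, h'⟩ := h q' (hq.trans hq')
    obtain ⟨r', hr', x⟩ := (fEq_mk.1 h').2 j r le_rfl (hj.trans (hq'.trans hr)) r le_rfl
    exact ⟨r', hr.trans hr', x⟩

theorem fMem_of_dense {σ τ : PName P} {p : P} (h : ∀ q, p ≤ q → ∃ r, q ≤ r ∧ fMem σ τ r) :
    fMem σ τ p := by
  cases τ
  rw [fMem_mk]
  intro q hq
  obtain ⟨r, hr, h'⟩ := h q hq
  obtain ⟨r', hr', x⟩ := fMem_mk.1 h' r le_rfl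
  exact ⟨r', hr.trans hr', x⟩

theorem fEq_refl (σ : PName P) (p : P) : fEq σ σ p := by
  induction σ generalizing p with
  | mk I A c ih =>
    rw [fEq_mk]
    exact ⟨fun i q _ hi q' hq' => ⟨q', le_rfl, i, hi.trans hq', ih i q'⟩,
      fun i q _ hi q' hq' => ⟨q', le_rfl, i, hi.trans hq', ih i q'⟩⟩

theorem fEq_symm {σ τ : PName P} {p : P} (h : fEq σ τ p) : fEq τ σ p := by
  induction σ generalizing τ p with
  | mk I A c ih =>
    cases τ
    rw [fEq_mk] at h ⊢
    constructor
    · intro j q hq hj q' hq'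
      obtain ⟨r, hr, i, hi, e⟩ := h.2 j q hq hj q' hq'
      exact ⟨r, hr, i, hi, ih i e⟩
    · intro i q hq hi q' hq'
      obtain ⟨r, hr, j, hj, e⟩ := h.1 i q hq hi q' hq'
      exact ⟨r, hr, j, hj, ih i e⟩

theorem fEq_trans {σ τ υ : PName P} {p : P} (h : fEq σ τ p) (h' : fEq τ υ p) : fEq σ υ p := by
  induction σ generalizing τ υ p with
  | mk I A c ih =>
    cases τ; cases υ
    rw [fEq_mk] at h h' ⊢
    constructor
    · intro i q hq hi q' hq'
      obtain ⟨r, hr, j, hj, e⟩ := h.1 i q hq hi q' hq'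
      obtain ⟨s, hs, k, hk, e'⟩ := h'.1 j r (hq.trans (hq'.trans hr)) hj r le_rfl
      exact ⟨s, hr.trans hs, k, hk, ih i (fEq_mono hs e) e'⟩
    · intro k q hq hk q' hq'
      obtain ⟨r, hr, j, hj, e⟩ := h'.2 k q hq hk q' hq'
      obtain ⟨s, hs, i, hi, e'⟩ := h.2 j r (hq.trans (hq'.trans hr)) hj r le_rfl
      exact ⟨s, hr.trans hs, i, hi, ih i e' (fEq_mono hs e)⟩

theorem fMem_congr_right {σ τ τ' : PName P} {p : P} (e : fEq τ τ' p) (h : fMem σ τ p) :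
    fMem σ τ' p := by
  cases τ; cases τ'
  rw [fMem_mk] at h ⊢
  rw [fEq_mk] at e
  intro q hq
  obtain ⟨r, hr, j, hj, h'⟩ := h q hq
  obtain ⟨s, hs, k, hk, e'⟩ := e.1 j r (hq.trans hr) hj r le_rfl
  exact ⟨s, hr.trans hs, k, hk, fEq_trans (fEq_mono hs h') e'⟩

theorem fMem_of_cond {J : Type u} {B : J → PName P} {d : J → P} {p : P} (j : J) (hj : d j ≤ p) :
    fMem (B j) (.mk J B d) p :=
  fMem_mk.2 fun q hq => ⟨q, le_rfl, j, hj.trans hq, fEq_refl _ _⟩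

/-! ### Pairs and ordinals -/

theorem fMem_upName {ρ σ τ : PName P} {p : P} :
    fMem ρ (upName σ τ) p ↔ ∀ q, p ≤ q → ∃ r, q ≤ r ∧ (fEq ρ σ r ∨ fEq ρ τ r) := by
  rw [upName, fMem_mk]
  refine forall₂_congr fun q _ => exists_congr fun r => and_congr_right fun _ => ?_
  constructor
  · rintro ⟨⟨⟨_ | _⟩, s⟩, hs, e⟩
    · exact Or.inr (by simpa using e)
    · exact Or.inl (by simpa using e)
  · rintro (e | e)
    · exact ⟨(⟨true⟩, r), le_rfl, by simpa using e⟩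
    · exact ⟨(⟨false⟩, r), le_rfl, by simpa using e⟩

theorem fMem_upName_left (σ τ : PName P) (p : P) : fMem σ (upName σ τ) p :=
  fMem_upName.2 fun q _ => ⟨q, le_rfl, Or.inl (fEq_refl _ _)⟩

theorem fMem_upName_right (σ τ : PName P) (p : P) : fMem τ (upName σ τ) p :=
  fMem_upName.2 fun q _ => ⟨q, le_rfl, Or.inr (fEq_refl _ _)⟩

theorem fMem_upName_self {ρ σ : PName P} {p : P} (h : fMem ρ (upName σ σ) p) : fEq ρ σ p :=
  fEq_of_dense fun q hq => by simpa using fMem_upName.1 h q hq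

theorem fEq_of_singleton_eq {σ τ τ' : PName P} {p : P} (h : fEq (upName σ σ) (upName τ τ') p) :
    fEq σ τ p ∧ fEq σ τ' p :=
  ⟨fEq_symm (fMem_upName_self (fMem_congr_right (fEq_symm h) (fMem_upName_left τ τ' p))),
    fEq_symm (fMem_upName_self (fMem_congr_right (fEq_symm h) (fMem_upName_right τ τ' p)))⟩

theorem opName_inj_fst {σ σ' τ τ' : PName P} {p : P} (h : fEq (opName σ τ) (opName σ' τ') p) :
    fEq σ σ' p := by
  refine fEq_of_dense fun q hq => ?_
  obtain ⟨r, hr, e⟩ :=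
    fMem_upName.1 (fMem_congr_right h (fMem_upName_left (upName σ σ) (upName σ τ) p)) q hq
  exact ⟨r, hr, e.elim (fun e => (fEq_of_singleton_eq e).1) fun e => (fEq_of_singleton_eq e).1⟩

/-- If two ordered pairs are forced to be equal, then the second entry of the first is forced to be
one of the two entries of the second: it belongs to `{σ', τ'}` or to `{σ'}`. -/
theorem opName_snd_dense {σ σ' τ τ' : PName P} {p : P} (h : fEq (opName σ τ) (opName σ' τ') p) :
    ∀ q, p ≤ q → ∃ r, q ≤ r ∧ (fEq τ σ' r ∨ fEq τ τ' r) := by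
  intro q hq
  obtain ⟨r, hr, e⟩ :=
    fMem_upName.1 (fMem_congr_right h (fMem_upName_right (upName σ σ) (upName σ τ) p)) q hq
  have ht : ∃ s, fMem τ (upName σ' s) r ∧ (s = σ' ∨ s = τ') := by
    rcases e with e | e
    · exact ⟨σ', fMem_congr_right e (fMem_upName_right σ τ r), Or.inl rfl⟩
    · exact ⟨τ', fMem_congr_right e (fMem_upName_right σ τ r), Or.inr rfl⟩
  obtain ⟨s, hs, hs'⟩ := ht
  obtain ⟨r', hr', e'⟩ := fMem_upName.1 hs r le_rfl
  refine ⟨r', hr.trans hr', ?_⟩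
  rcases hs' with rfl | rfl
  · exact Or.inl (by simpa using e')
  · exact e'

theorem opName_inj_snd {σ σ' τ τ' : PName P} {p : P} (h : fEq (opName σ τ) (opName σ' τ') p) :
    fEq τ τ' p := by
  refine fEq_of_dense fun q hq => ?_
  obtain ⟨r, hr, e⟩ := opName_snd_dense h q hq
  obtain ⟨s, hs, e'⟩ := opName_snd_dense (fEq_symm h) r (hq.trans hr)
  refine ⟨s, hr.trans hs, ?_⟩
  rcases e with e | e
  -- If `τ = σ'` and `τ' = σ`, then `σ = σ'` makes all four entries equal.
  · rcases e' with e' | e'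
    · have e₁ := fEq_mono (hq.trans (hr.trans hs)) (opName_inj_fst h)
      exact fEq_trans (fEq_mono hs e) (fEq_trans (fEq_symm e₁) (fEq_symm e'))
    · exact fEq_symm e'
  · exact fEq_mono hs e

theorem fMem_ordName {σ : PName P} {α : Ordinal.{u}} {p : P} :
    fMem σ (ordName α) p ↔ ∀ q, p ≤ q → ∃ r, q ≤ r ∧ ∃ β < α, fEq σ (ordName β) r := by
  rw [ordName, fMem_mk]
  refine forall₂_congr fun q _ => exists_congr fun r => and_congr_right fun _ => ?_
  constructor
  · rintro ⟨x, -, e⟩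
    exact ⟨x.1.toOrd.1, x.1.toOrd.2, e⟩
  · rintro ⟨β, hβ, e⟩
    refine ⟨(Ordinal.ToType.mk ⟨β, hβ⟩, r), le_rfl, ?_⟩
    have : (Ordinal.ToType.mk (⟨β, hβ⟩ : Set.Iio α)).toOrd = ⟨β, hβ⟩ :=
      Ordinal.ToType.mk.symm_apply_apply _
    simpa only [this] using e

/-- If `α = β` with `β < α` were forced, then `β ∈ β` would be, and some condition would force
`β = γ` for a `γ < β`. -/
theorem not_fEq_ordName_of_lt {α β : Ordinal.{u}} (h : β < α) (p : P) :
    ¬ fEq (ordName α) (ordName β) p := by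
  induction α using WellFoundedLT.induction generalizing β p with
  | ind α ih =>
    intro e
    have hmem : fMem (ordName (P := P) β) (ordName α) p :=
      fMem_ordName.2 fun q _ => ⟨q, le_rfl, β, h, fEq_refl _ _⟩
    obtain ⟨r, -, γ, hγ, e'⟩ := fMem_ordName.1 (fMem_congr_right e hmem) p le_rfl
    exact ih β h hγ r e'

theorem ordName_inj {α β : Ordinal.{u}} {p : P} (h : fEq (ordName (P := P) α) (ordName β) p) :
    α = β := by
  rcases lt_trichotomy α β with h' | h' | h'
  · exact (not_fEq_ordName_of_lt h' p (fEq_symm h)).elim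
  · exact h'
  · exact (not_fEq_ordName_of_lt h' p h).elim

/-! ### Functions of the extension given by compatible families of values -/

/-- The name of the function with domain `{dom a : a ∈ A}` whose value at `dom a` is `val y`
whenever a condition `p` with `R p a y` lies in the generic filter. -/
def graphName {A Y : Type u} (dom : A → PName P) (val : Y → PName P) (R : P → A → Y → Prop) :
    PName P :=
  .mk {t : P × A × Y // R t.1 t.2.1 t.2.2} (fun t => opName (dom t.1.2.1) (val t.1.2.2))
    fun t => t.1.1

variable {A Y : Type u} {dom : A → PName P} {val : Y → PName P} {R : P → A → Y → Prop}

theorem fMem_graphName {p : P} {a : A} {y : Y} (h : R p a y) :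
    fMem (opName (dom a) (val y)) (graphName dom val R) p :=
  fMem_of_cond (B := fun t : {t : P × A × Y // R t.1 t.2.1 t.2.2} =>
    opName (dom t.1.2.1) (val t.1.2.2)) ⟨(p, a, y), h⟩ le_rfl

theorem exists_of_fMem_graphName (hR : ∀ ⦃p q a y⦄, p ≤ q → R p a y → R q a y) {z : PName P}
    {p : P} (h : fMem z (graphName dom val R) p) :
    ∃ r, p ≤ r ∧ ∃ a y, R r a y ∧ fEq z (opName (dom a) (val y)) r := by
  obtain ⟨r, hr, ⟨⟨q, a, y⟩, ht⟩, hq, e⟩ := fMem_mk.1 h p le_rfl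
  exact ⟨r, hr, a, y, hR hq ht, e⟩

theorem exists_of_fMem_op_graphName (hR : ∀ ⦃p q a y⦄, p ≤ q → R p a y → R q a y)
    (hdom : ∀ ⦃a a' p⦄, fEq (dom a) (dom a') p → a = a') {a : A} {x : PName P}
    {p : P} (h : fMem (opName (dom a) x) (graphName dom val R) p) :
    ∃ r, p ≤ r ∧ ∃ y, R r a y ∧ fEq x (val y) r := by
  obtain ⟨r, hr, a', y, ht, e⟩ := exists_of_fMem_graphName hR h
  obtain rfl := hdom (opName_inj_fst e)
  exact ⟨r, hr, y, ht, opName_inj_snd e⟩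

/-- The name `graphName dom val R` is forced to be a function as soon as the relation `R` is
monotone, decides at most one value and densely decides every value. -/
theorem fIsFun_graphName {A' : Type*} {dom' : A' → PName P} {φ : PName P → FProp P}
    (e : A' → A) (he : Function.Surjective e) (hd : ∀ a, dom' a = dom (e a))
    (hR : ∀ ⦃p q a y⦄, p ≤ q → R p a y → R q a y)
    (huniq : ∀ ⦃p a y y'⦄, R p a y → R p a y' → y = y')
    (hdense : ∀ p a, ∃ q, p ≤ q ∧ ∃ y, R q a y)
    (hdom : ∀ ⦃a a' p⦄, fEq (dom a) (dom a') p → a = a') (hφ : ∀ y p, φ (val y) p) (p : P) :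
    fIsFun dom' φ (graphName dom val R) p := by
  refine ⟨fun z q _ hz q' hq' => ?_, fun a' q _ => ?_, fun a' x y q _ hxy => ?_⟩
  · obtain ⟨r, hr, a, y, -, hz'⟩ := exists_of_fMem_graphName hR (fMem_mono hq' hz)
    obtain ⟨a', rfl⟩ := he a
    refine ⟨r, hr, a', fun s hs => ⟨s, le_rfl, val y, hφ y s, ?_⟩⟩
    rw [hd]
    exact fEq_mono hs hz'
  · obtain ⟨r, hr, y, h⟩ := hdense q (e a')
    exact ⟨r, hr, val y, by rw [hd]; exact fMem_graphName h⟩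
  · refine fEq_of_dense fun q' hq' => ?_
    have hx := fMem_mono hq' hxy.1
    have hy := fMem_mono hq' hxy.2
    rw [hd] at hx hy
    obtain ⟨r, hr, v, hv, ex⟩ := exists_of_fMem_op_graphName hR hdom hx
    obtain ⟨s, hs, v', hv', ey⟩ := exists_of_fMem_op_graphName hR hdom (fMem_mono hr hy)
    obtain rfl := huniq (hR hs hv) hv'
    exact ⟨s, hr.trans hs, fEq_trans (fEq_mono hs ex) (fEq_symm ey)⟩

end ForcingBasics

/-! ### Generic reals -/

section GenericReals

variable {P : Type u} [PartialOrder P]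

/-- An element of `2^ω` of the extension, given by its values: `val p n i` says that the condition
`p` decides the value at `n` to be `i`. -/
structure GenericReal (P : Type u) [PartialOrder P] where
  val : P → ℕ → ZMod 2 → Prop
  mono : ∀ ⦃p q n i⦄, p ≤ q → val p n i → val q n i
  uniq : ∀ ⦃p n i j⦄, val p n i → val p n j → i = j
  dense : ∀ p n, ∃ q, p ≤ q ∧ ∃ i, val q n i

namespace GenericReal

/-- The name of a generic real. -/
noncomputable def name (x : GenericReal P) : PName P :=
  graphName (A := ULift.{u} ℕ) (Y := ULift.{u} (ZMod 2)) (fun n => ordName (n.down : Ordinal.{u}))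
    (fun i => ordName (i.down.val : Ordinal.{u})) fun p n i => x.val p n.down i.down

theorem natName_inj ⦃m n : ULift.{u} ℕ⦄ ⦃p : P⦄
    (h : fEq (ordName (m.down : Ordinal.{u})) (ordName (n.down : Ordinal.{u})) p) : m = n :=
  ULift.ext _ _ (by exact_mod_cast ordName_inj h)

/-- Monotonicity of the values, in the form used by `graphName`. -/
theorem mono_ulift (x : GenericReal P) ⦃p q : P⦄ ⦃n : ULift.{u} ℕ⦄ ⦃i : ULift.{u} (ZMod 2)⦄
    (h : p ≤ q) (h' : x.val p n.down i.down) : x.val q n.down i.down :=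
  x.mono h h'

theorem fCantor_name (x : GenericReal P) (p : P) : fCantor x.name p := by
  have hφ : ∀ (i : ULift.{u} (ZMod 2)) (p : P), fOr (fEq (ordName (i.down.val : Ordinal.{u}))
      (ordName 0)) (fEq (ordName (i.down.val : Ordinal.{u})) (ordName 1)) p := by
    rintro ⟨i⟩ p q -
    refine ⟨q, le_rfl, ?_⟩
    obtain h | h : i.val = 0 ∨ i.val = 1 := by
      have := ZMod.val_lt i
      omega
    · exact Or.inl (by simpa [h] using fEq_refl (ordName 0) q)
    · exact Or.inr (by simpa [h] using fEq_refl (ordName 1) q)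
  refine fIsFun_graphName (fun n : ℕ => ULift.up n) (fun n => ⟨n.down, rfl⟩) (fun _ => rfl)
    x.mono_ulift (fun _ _ _ _ h h' => ULift.ext _ _ (x.uniq h h'))
    (fun p n => ?_) natName_inj hφ p
  obtain ⟨q, hq, i, hi⟩ := x.dense p n.down
  exact ⟨q, hq, ⟨i⟩, hi⟩

theorem fVal_name {x : GenericReal P} {p : P} {n : ℕ} {i : ZMod 2} (h : x.val p n i) :
    fVal x.name n i p :=
  fMem_graphName (A := ULift.{u} ℕ) (Y := ULift.{u} (ZMod 2)) (a := ⟨n⟩) (y := ⟨i⟩)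
    (dom := fun n => ordName (n.down : Ordinal.{u}))
    (val := fun i => ordName (i.down.val : Ordinal.{u}))
    (R := fun p n i => x.val p n.down i.down) h

/-- If `p` forces a value, then some extension of `p` decides it. -/
theorem exists_val_of_fVal {x : GenericReal P} {p : P} {n : ℕ} {i : ZMod 2}
    (h : fVal x.name n i p) : ∃ q, p ≤ q ∧ x.val q n i := by
  obtain ⟨q, hq, y, hy, e⟩ := exists_of_fMem_op_graphName (A := ULift.{u} ℕ)
    (Y := ULift.{u} (ZMod 2)) (a := ⟨n⟩) x.mono_ulift natName_inj h
  have hi : i = y.down := ZMod.val_injective 2 (by exact_mod_cast ordName_inj e)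
  exact ⟨q, hq, hi ▸ hy⟩

theorem not_fEq_name {x y : GenericReal P} {p : P} {n : ℕ} {i j : ZMod 2} (hx : x.val p n i)
    (hy : y.val p n j) (hij : i ≠ j) : ¬ fEq x.name y.name p := by
  intro e
  obtain ⟨q, hq, h⟩ := exists_val_of_fVal (x := y) (fMem_congr_right e (fVal_name hx))
  exact hij (y.uniq h (y.mono hq hy))

theorem fAdd_name {x y z : GenericReal P} (h : ∀ p n i j, x.val p n i → y.val p n j →
    ∃ q, p ≤ q ∧ z.val q n (i + j)) (p : P) : fAdd x.name y.name z.name p := by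
  intro n i j q _ hq
  refine fMem_of_dense fun r hr => ?_
  obtain ⟨s, hs, hx⟩ := exists_val_of_fVal (fMem_mono hr hq.1)
  obtain ⟨t, ht, hy⟩ := exists_val_of_fVal (fMem_mono (hr.trans hs) hq.2)
  obtain ⟨w, hw, hz⟩ := h t n i j (x.mono ht hx) hy
  exact ⟨w, hs.trans (ht.trans hw), fVal_name hz⟩

/-- The coordinatewise sum of two generic reals. -/
def add (x y : GenericReal P) : GenericReal P where
  val p n k := ∃ i j, x.val p n i ∧ y.val p n j ∧ i + j = k
  mono := fun _ _ _ _ h ⟨i, j, hi, hj, e⟩ => ⟨i, j, x.mono h hi, y.mono h hj, e⟩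
  uniq := by
    rintro p n _ _ ⟨i, j, hi, hj, rfl⟩ ⟨i', j', hi', hj', rfl⟩
    rw [x.uniq hi hi', y.uniq hj hj']
  dense := fun p n => by
    obtain ⟨q, hq, i, hi⟩ := x.dense p n
    obtain ⟨r, hr, j, hj⟩ := y.dense q n
    exact ⟨r, hq.trans hr, _, i, j, x.mono hr hi, hj, rfl⟩

/-- A generic real all of whose initial segments are densely forced to be nodes of `T` is forced to
be a branch of `T`. -/
theorem fBranch_name {T : NodeSet} {x : GenericReal P} {p : P}
    (h : ∀ q, p ≤ q → ∀ n, ∃ r, q ≤ r ∧ ∃ s ∈ T n, ∀ k : Fin n, x.val r k (s k)) :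
    fBranch T x.name p := by
  refine ⟨x.fCantor_name p, fun n q hq => ?_⟩
  obtain ⟨r, hr, s, hs, hk⟩ := h q hq n
  exact ⟨r, hr, ⟨s, hs⟩, fun k => fVal_name (hk k)⟩

theorem fTranslate_name {T : ℕ → NodeSet} {x y z : GenericReal P} {p : P} {σ : PName P}
    (hσ : fEq σ x.name p) (hy : fB T y.name p) (hz : fAdd x.name y.name z.name p) :
    fTranslate T σ z.name p :=
  ⟨z.fCantor_name p, fun q hq => ⟨q, le_rfl, y.name, fun r hr => hy r (hq.trans hr),
    fun n i j r hr h => hz n i j r (hq.trans hr)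
      ⟨fMem_congr_right (fEq_mono (hq.trans hr) hσ) h.1, h.2⟩⟩⟩

end GenericReal

/-- It suffices to find, in the ground model, a family of `κ` generic reals `x α` any two of
which are forced to be distinct and to have a large overlap.  The overlaps are considered for
arbitrary names `σ`, `τ` forced to be equal to the `x α`, as the sequence is evaluated at those. -/
theorem forced_fManyOverlaps {κ : Cardinal.{u}} {T : ℕ → NodeSet} {N : ℕ}
    (x : κ.ord.ToType → GenericReal P)
    (hne : ∀ α β, α ≠ β → ∀ p, ¬ fEq (x α).name (x β).name p)
    (hov : ∀ α β p σ τ, fEq σ (x α).name p → fEq τ (x β).name p → fOverlap T N σ τ p) :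
    Forced (fManyOverlaps (P := P) κ T N) := by
  have hdom : ∀ ⦃a a' : κ.ord.ToType⦄ ⦃p : P⦄,
      fEq (ordName a.toOrd.1) (ordName a'.toOrd.1) p → a = a' := fun a a' p h =>
    Ordinal.ToType.mk.symm.injective (Subtype.ext (ordName_inj h))
  have hd : ∀ α : Set.Iio κ.ord, (Ordinal.ToType.mk α).toOrd = α := fun α =>
    Ordinal.ToType.mk.symm_apply_apply α
  let f : PName P := graphName (A := κ.ord.ToType) (Y := κ.ord.ToType)
    (fun a => ordName a.toOrd.1) (fun a => (x a).name) fun _ a y => a = y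
  refine fun p q _ => ⟨q, le_rfl, f, ?_, ?_⟩
  · exact fIsFun_graphName (fun α => Ordinal.ToType.mk α) Ordinal.ToType.mk.surjective
      (fun α => by rw [hd]) (fun _ _ _ _ _ h => h) (fun _ _ _ _ h h' => h.symm.trans h')
      (fun p a => ⟨p, le_rfl, a, rfl⟩) hdom (fun a p => (x a).fCantor_name p) q
  · have hval : ∀ (α : Set.Iio κ.ord) (σ : PName P) (r : P),
        fMem (opName (ordName α.1) σ) f r → fEq σ (x (Ordinal.ToType.mk α)).name r := by
      intro α σ r h
      refine fEq_of_dense fun s hs => ?_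
      have h' := fMem_mono hs h
      rw [← hd α] at h'
      obtain ⟨t, ht, y, rfl, e⟩ := exists_of_fMem_op_graphName (fun _ _ _ _ _ h => h) hdom h'
      exact ⟨t, ht, e⟩
    intro α β σ τ r _ h
    have hσ := hval α σ r h.1
    have hτ := hval β τ r h.2
    refine ⟨fun hαβ s hs e => hne _ _ (Ordinal.ToType.mk.injective.ne hαβ.down) s ?_,
      hov _ _ r σ τ hσ hτ⟩
    exact fEq_trans (fEq_symm (fEq_mono hs hσ)) (fEq_trans e (fEq_mono hs hτ))

end GenericReals

/-! ### Positions in finite sets -/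

section Position

variable {X : Type*} [LinearOrder X] {w : Finset X}

theorem pos_mono (w : Finset X) : Monotone (pos w) := fun _ _ h =>
  Finset.card_le_card (Finset.monotone_filter_right w fun _ _ hx => lt_of_lt_of_le hx h)

theorem pos_lt_pos {a b : X} (ha : a ∈ w) (h : a < b) : pos w a < pos w b := by
  refine Finset.card_lt_card (Finset.ssubset_iff_of_subset ?_ |>.2 ⟨a, by simp [ha, h], by simp⟩)
  exact Finset.monotone_filter_right w fun _ _ hx => lt_trans hx h

theorem pos_lt_card {a : X} (ha : a ∈ w) : pos w a < w.card :=
  Finset.card_lt_card (Finset.filter_ssubset.2 ⟨a, ha, lt_irrefl a⟩)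

theorem pos_injOn (w : Finset X) : Set.InjOn (pos w) w :=
  StrictMonoOn.injOn fun _ ha _ _ h => pos_lt_pos ha h

theorem pos_insert_of_le {x y : X} (h : y ≤ x) : pos (insert x w) y = pos w y := by
  rw [pos, pos, Finset.filter_insert, if_neg (not_lt.2 h)]

theorem pos_image {Y : Type*} [LinearOrder Y] {f : X → Y} (hf : StrictMonoOn f w) {x : X}
    (hx : x ∈ w) : pos (w.image f) (f x) = pos w x := by
  have : (w.image f).filter (· < f x) = (w.filter (· < x)).image f := by
    ext y
    simp only [Finset.mem_filter, Finset.mem_image]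
    constructor
    · rintro ⟨⟨z, hz, rfl⟩, h⟩
      exact ⟨z, ⟨hz, (hf.lt_iff_lt hz hx).1 h⟩, rfl⟩
    · rintro ⟨z, ⟨hz, h⟩, rfl⟩
      exact ⟨⟨z, hz, rfl⟩, (hf.lt_iff_lt hz hx).2 h⟩
  rw [pos, this, Finset.card_image_of_injOn, pos]
  exact hf.injOn.mono fun y hy => (Finset.mem_filter.1 hy).1

/-- An element `b ∉ w` in the same position as `a ∈ w` lies just below `a`. -/
theorem lt_of_pos_eq {a b : X} (ha : a ∈ w) (hb : b ∉ w) (h : pos w b = pos w a) : b < a := by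
  by_contra hab
  have hne : a ≠ b := fun e => hb (e ▸ ha)
  exact (pos_lt_pos ha (lt_of_le_of_ne (not_lt.1 hab) hne)).ne' h

theorem strictMonoOn_update {a b : X} (ha : a ∈ w) (hb : b ∉ w) (h : pos w b = pos w a) :
    StrictMonoOn (Function.update id a b) (w : Set X) := by
  have hba := lt_of_pos_eq ha hb h
  intro x hx y hy hxy
  rcases eq_or_ne x a with rfl | hxa
  · simpa [Function.update_of_ne hxy.ne'] using hba.trans hxy
  · rcases eq_or_ne y a with rfl | hya
    · rw [Function.update_self, Function.update_of_ne hxa, id]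
      by_contra hbx
      exact ((pos_mono w (not_lt.1 hbx)).trans_lt (pos_lt_pos hx hxy)).ne h
    · simpa [Function.update_of_ne hxa, Function.update_of_ne hya] using hxy

theorem image_update {a b : X} (ha : a ∈ w) :
    w.image (Function.update id a b) = insert b (w.erase a) := by
  ext y
  simp only [Finset.mem_image, Finset.mem_insert, Finset.mem_erase]
  constructor
  · rintro ⟨x, hx, rfl⟩
    rcases eq_or_ne x a with rfl | hxa
    · simp
    · simp [hxa, hx]
  · rintro (rfl | ⟨hya, hy⟩)
    · exact ⟨a, ha, by simp⟩
    · exact ⟨y, hy, by simp [hya]⟩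

variable [Nonempty X]

open Classical in
/-- The increasing enumeration of a finite set, with a fixed junk value beyond its size. -/
noncomputable def enum (w : Finset X) (i : ℕ) : X :=
  if h : ∃ x ∈ w, pos w x = i then h.choose else Classical.arbitrary X

theorem enum_pos {x : X} (hx : x ∈ w) : enum w (pos w x) = x := by
  have h : ∃ y ∈ w, pos w y = pos w x := ⟨x, hx, rfl⟩
  rw [enum, dif_pos h]
  exact pos_injOn w h.choose_spec.1 hx h.choose_spec.2

theorem enum_of_not_exists {i : ℕ} (h : ¬ ∃ x ∈ w, pos w x = i) :
    enum w i = Classical.arbitrary X := dif_neg h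

/-- Replacing `a ∈ w` by an element `b ∉ w` in the same position changes the enumeration of `w` only
there. -/
theorem enum_insert_erase {a b : X} (ha : a ∈ w) (hb : b ∉ w) (h : pos w b = pos w a) :
    enum (insert b (w.erase a)) = Function.update (enum w) (pos w a) b := by
  have hf := strictMonoOn_update ha hb h
  rw [← image_update ha]
  funext i
  by_cases hi : ∃ x ∈ w, pos w x = i
  · obtain ⟨x, hx, rfl⟩ := hi
    rw [← pos_image hf hx, enum_pos (Finset.mem_image_of_mem _ hx), pos_image hf hx]
    rcases eq_or_ne x a with rfl | hxa
    · simp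
    · rw [Function.update_of_ne ((pos_injOn w).ne hx ha hxa), Function.update_of_ne hxa,
        enum_pos hx, id]
  · have hia : i ≠ pos w a := fun e => hi ⟨a, ha, e.symm⟩
    rw [Function.update_of_ne hia, enum_of_not_exists hi, enum_of_not_exists]
    rintro ⟨y, hy, rfl⟩
    obtain ⟨x, hx, rfl⟩ := Finset.mem_image.1 hy
    exact hi ⟨x, hx, (pos_image hf hx).symm⟩

end Position

/-! ### The splitting rank -/

section SplittingRank

open FirstOrder

variable (L : FirstOrder.Language.{0, 0}) {Λ : Type u} [DecidableEq Λ] [L.Structure Λ]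

theorem rankGE_zero {w : Finset Λ} : RankGE L (0 : Ordinal.{u}) w ↔
    ∀ φ : L.Formula {a // a ∈ w}, FirstOrder.Language.BoundedFormula.IsQF φ →
      φ.Realize (fun a => (a : Λ)) → ∀ k : {a // a ∈ w},
        ¬ {α : Λ | φ.Realize (Function.update (fun a => (a : Λ)) k α)}.Countable := by
  rw [RankGE, Ordinal.limitRecOn_zero]

theorem rankGE_add_one {δ : Ordinal.{u}} {w : Finset Λ} : RankGE L (δ + 1) w ↔
    ∀ φ : L.Formula {a // a ∈ w}, FirstOrder.Language.BoundedFormula.IsQF φ →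
      φ.Realize (fun a => (a : Λ)) → ∀ k : {a // a ∈ w},
        ∃ α : Λ, α ∉ w ∧ RankGE L δ (insert α w) ∧
          φ.Realize (Function.update (fun a => (a : Λ)) k α) := by
  rw [RankGE, Ordinal.limitRecOn_add_one]
  rfl

theorem rankGE_limit {δ : Ordinal.{u}} (hδ : Order.IsSuccLimit δ) {w : Finset Λ} :
    RankGE L δ w ↔ ∀ γ < δ, RankGE L γ w := by
  rw [RankGE, Ordinal.limitRecOn_limit _ _ _ _ hδ]
  rfl

/-- The rank decreases as the finite set grows: a formula about the smaller set is a formula about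
the larger one. -/
theorem RankGE.mono {δ : Ordinal.{u}} {v w : Finset Λ} (hvw : v ⊆ w) (h : RankGE L δ w) :
    RankGE L δ v := by
  induction δ using Ordinal.limitRecOn generalizing v w with
  | zero =>
    rw [rankGE_zero] at h ⊢
    intro φ hφ hr k hc
    let i : {a // a ∈ v} → {a // a ∈ w} := fun a => ⟨a, hvw a.2⟩
    have hi : Function.Injective i := fun a b e => Subtype.ext (congrArg (fun x => x.1) e)
    refine h (φ.relabel i) (hφ.relabel _) (Language.Formula.realize_relabel.2 hr) (i k) ?_
    convert hc using 3 with α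
    rw [Language.Formula.realize_relabel, Function.update_comp_eq_of_injective _ hi]
    rfl
  | add_one δ ih =>
    rw [rankGE_add_one] at h ⊢
    intro φ hφ hr k
    let i : {a // a ∈ v} → {a // a ∈ w} := fun a => ⟨a, hvw a.2⟩
    have hi : Function.Injective i := fun a b e => Subtype.ext (congrArg (fun x => x.1) e)
    obtain ⟨α, hα, hα', hα''⟩ :=
      h (φ.relabel i) (hφ.relabel _) (Language.Formula.realize_relabel.2 hr) (i k)
    rw [Language.Formula.realize_relabel, Function.update_comp_eq_of_injective _ hi] at hα''
    exact ⟨α, fun h' => hα (hvw h'), ih (Finset.insert_subset_insert α hvw) hα', hα''⟩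
  | limit δ hδ ih =>
    rw [rankGE_limit L hδ] at h ⊢
    exact fun γ hγ => ih γ hγ hvw (h γ hγ)

/-- The relation `rk(w) ≥ δ` is downward closed in `δ`: at a successor step the witness for the
formula `⊤` gives a larger set of rank at least `δ`, and `RankGE.mono` applies. -/
theorem RankGE.of_le {γ δ : Ordinal.{u}} {w : Finset Λ} (hw : w.Nonempty) (hγ : γ ≤ δ)
    (h : RankGE L δ w) : RankGE L γ w := by
  induction δ using Ordinal.limitRecOn with
  | zero => rwa [nonpos_iff_eq_zero.1 hγ]
  | add_one δ ih =>
    rcases hγ.eq_or_lt with rfl | hγ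
    · exact h
    · refine ih (Order.lt_add_one_iff.1 hγ) ?_
      obtain ⟨α, -, hα, -⟩ := (rankGE_add_one L).1 h ⊤ .top (by simp) ⟨_, hw.choose_spec⟩
      exact RankGE.mono L (Finset.subset_insert α w) hα
  | limit δ hδ ih =>
    rcases hγ.eq_or_lt with rfl | hγ
    · exact h
    · exact (rankGE_limit L hδ).1 h γ hγ

/-- The least upper bound of the ordinals `1 + δ` with `rk(w) ≥ δ`; this is `1 + rk(w)`.  When these
ordinals are unbounded the value is a junk `0`. -/
noncomputable def rankVal (w : Finset Λ) : Ordinal.{u} :=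
  sInf {ρ | ∀ δ : Ordinal.{u}, RankGE L δ w → 1 + δ ≤ ρ}

variable {L} {ε : Ordinal.{u}}

theorem le_rankVal {w : Finset Λ} (hb : ∀ δ : Ordinal.{u}, RankGE L δ w → 1 + δ ≤ ε)
    {δ : Ordinal.{u}} (h : RankGE L δ w) : 1 + δ ≤ rankVal L w :=
  csInf_mem (s := {ρ | ∀ δ : Ordinal.{u}, RankGE L δ w → 1 + δ ≤ ρ}) ⟨ε, hb⟩ δ h

theorem rankVal_le {w : Finset Λ} {ρ : Ordinal.{u}}
    (h : ∀ δ : Ordinal.{u}, RankGE L δ w → 1 + δ ≤ ρ) : rankVal L w ≤ ρ :=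
  csInf_le' h

theorem rankVal_anti {v w : Finset Λ} (hb : ∀ δ : Ordinal.{u}, RankGE L δ v → 1 + δ ≤ ε)
    (hvw : v ⊆ w) : rankVal L w ≤ rankVal L v :=
  rankVal_le fun _ h => le_rankVal hb (RankGE.mono L hvw h)

theorem not_rankGE_of_rankVal_eq_zero {w : Finset Λ}
    (hb : ∀ δ : Ordinal.{u}, RankGE L δ w → 1 + δ ≤ ε) (h : rankVal L w = 0) :
    ¬ RankGE L (0 : Ordinal.{u}) w := by
  intro h'
  have := le_rankVal hb h'
  simp [h] at this

/-- If `rk(w) ≥ 0`, then the value `rankVal L w = 1 + δ` is attained at `δ = rk(w)`. -/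
theorem exists_rankVal_eq {w : Finset Λ} (hw : w.Nonempty)
    (hb : ∀ δ : Ordinal.{u}, RankGE L δ w → 1 + δ ≤ ε) (h : rankVal L w ≠ 0) :
    ∃ δ, rankVal L w = 1 + δ ∧ RankGE L δ w ∧ ¬ RankGE L (δ + 1) w := by
  have hne : {δ : Ordinal.{u} | ¬ RankGE L δ w}.Nonempty := by
    refine ⟨ε + 1, fun h' => ?_⟩
    have h₁ : ε + 1 ≤ ε := le_trans le_add_self (hb _ h')
    exact absurd h₁ (by simp)
  have hlt : ∀ γ < sInf {δ : Ordinal.{u} | ¬ RankGE L δ w}, RankGE L γ w := fun γ hγ =>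
    not_not.1 (notMem_of_lt_csInf' hγ)
  have hmem := csInf_mem hne
  set R := sInf {δ : Ordinal.{u} | ¬ RankGE L δ w} with hR
  -- `R` is the least `δ` with `rk(w) ≥ δ` false; it is not a limit, so it is a successor or `0`.
  rcases Ordinal.zero_or_succ_or_isSuccLimit R with h0 | ⟨δ, hδ⟩ | hl
  · refine (h (nonpos_iff_eq_zero.1 (rankVal_le fun δ hδ => ?_))).elim
    rw [h0] at hmem
    exact (hmem (RankGE.of_le L hw (zero_le) hδ)).elim
  · rw [← hδ, Order.succ_eq_add_one] at hmem
    have hδ' : RankGE L δ w := hlt δ (hδ ▸ Order.lt_succ δ)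
    refine ⟨δ, le_antisymm (rankVal_le fun γ hγ => ?_) (le_rankVal hb hδ'), hδ', hmem⟩
    by_contra hc
    have : δ + 1 ≤ γ := by
      rw [Order.add_one_le_iff]
      by_contra hc'
      exact hc (by gcongr; exact not_lt.1 hc')
    exact hmem (RankGE.of_le L hw this hγ)
  · exact (hmem ((rankGE_limit L hl).2 hlt)).elim

end SplittingRank

/-! ### The system of a model without sets of large rank -/

section ModelSystem

open FirstOrder

variable {L : FirstOrder.Language.{0, 0}} {Λ : Type u} [LinearOrder Λ] [L.Structure Λ] [Nonempty Λ]

/-- The formula `Φ`, in which the `i`-th variable stands for the `i`-th element of `w`, and the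
element `a` of `w` witness that the rank of `w` is not larger than it is. -/
structure RankWitness (w : Finset Λ) (Φ : L.Formula ℕ) (a : Λ) : Prop where
  mem : a ∈ w
  realize : Φ.Realize (enum w)
  countable : rankVal L w = 0 → {α | Φ.Realize (Function.update (enum w) (pos w a) α)}.Countable
  not_realize : rankVal L w ≠ 0 → ∀ α ∉ w, rankVal L (insert α w) = rankVal L w →
    ¬ Φ.Realize (Function.update (enum w) (pos w a) α)

theorem exists_rankWitness {ε : Ordinal.{u}}
    (hb : ∀ w : Finset Λ, w.Nonempty → ∀ δ : Ordinal.{u}, RankGE L δ w → 1 + δ ≤ ε)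
    {w : Finset Λ} (hw : w.Nonempty) : ∃ (Φ : L.Formula ℕ) (a : Λ), RankWitness w Φ a := by
  let i : {a // a ∈ w} → ℕ := fun a => pos w a
  have hi : Function.Injective i := fun a b e => Subtype.ext (pos_injOn w a.2 b.2 e)
  have henum : enum w ∘ i = fun a : {a // a ∈ w} => (a : Λ) := funext fun a => enum_pos a.2
  by_cases h0 : rankVal L w = 0
  · have := not_rankGE_of_rankVal_eq_zero (hb w hw) h0
    rw [rankGE_zero] at this
    push Not at this
    obtain ⟨φ, -, hφ, a, ha⟩ := this
    refine ⟨φ.relabel i, a, a.2, ?_, fun _ => ?_, fun h => (h h0).elim⟩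
    · rwa [Language.Formula.realize_relabel, henum]
    · convert ha using 3 with α
      rw [Language.Formula.realize_relabel, Function.update_comp_eq_of_injective _ hi a, henum]
  · obtain ⟨δ, hδ, -, hδ'⟩ := exists_rankVal_eq hw (hb w hw) h0
    rw [rankGE_add_one] at hδ'
    push Not at hδ'
    obtain ⟨φ, -, hφ, a, ha⟩ := hδ'
    refine ⟨φ.relabel i, a, a.2, ?_, fun h => (h0 h).elim, fun _ α hα hr => ?_⟩
    · rwa [Language.Formula.realize_relabel, henum]
    · rw [Language.Formula.realize_relabel, Function.update_comp_eq_of_injective _ hi a, henum]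
      refine ha α hα ?_
      have hne : (insert α w).Nonempty := Finset.insert_nonempty α w
      obtain ⟨γ, hγ, hγ', -⟩ := exists_rankVal_eq hne (hb _ hne) (hr ▸ h0)
      rwa [← add_left_cancel (hγ.symm.trans (hr.trans hδ))]

/-- A model in a countable vocabulary in which `1 + rk(w) ≤ ε` for all `w` carries a system.  The
value `j w` codes the formula that bounds the rank of `w`, the place where it does so, and, when the
formula has only countably many solutions there, the index of the solution in `w`.  The countably
many singletons of rank `-1` receive the value `1` of `r`; their `j`-values are all distinct. -/
theorem nonempty_yzrSystem [WellFoundedLT Λ] [Countable L.Symbols] {ε : Ordinal.{u}} (hε : 0 < ε)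
    (hb : ∀ w : Finset Λ, w.Nonempty → ∀ δ : Ordinal.{u}, RankGE L δ w → 1 + δ ≤ ε) :
    Nonempty (YZRSystem Λ ε) := by
  classical
  have hwit : ∀ w : Finset Λ, ∃ (Φ : L.Formula ℕ) (a : Λ), w.Nonempty → RankWitness w Φ a := by
    intro w
    by_cases hw : w.Nonempty
    · obtain ⟨Φ, a, h⟩ := exists_rankWitness hb hw
      exact ⟨Φ, a, fun _ => h⟩
    · exact ⟨⊤, Classical.arbitrary Λ, fun h => (hw h).elim⟩
  choose Φ e hwit using hwit
  have hidx : ∀ C : Set Λ, ∃ f : Λ → ℕ, C.Countable → Set.InjOn f C := by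
    intro C
    by_cases hC : C.Countable
    · obtain ⟨f, hf⟩ := Set.countable_iff_exists_injOn.1 hC
      exact ⟨f, fun _ => hf⟩
    · exact ⟨fun _ => 0, fun h => (hC h).elim⟩
  choose idx hidx using hidx
  obtain ⟨code, hcode⟩ := exists_injective_nat (L.Formula ℕ × ℕ × ℕ)
  let C : Finset Λ → Set Λ := fun w =>
    {α | (Φ w).Realize (Function.update (enum w) (pos w (e w)) α)}
  let j : Finset Λ → ℕ := fun w =>
    code (Φ w, pos w (e w), if rankVal L w = 0 then idx (C w) (e w) + 1 else 0)
  let r : Finset Λ → Ordinal.{u} := fun w =>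
    if w.card ≤ 1 then max 1 (rankVal L w) else rankVal L w
  have hr_le : ∀ w, rankVal L w ≤ r w := by
    intro w
    by_cases h : w.card ≤ 1
    · simp only [r, if_pos h]; exact le_max_right _ _
    · simp only [r, if_neg h]; exact le_rfl
  have hone : 1 ≤ ε := Order.one_le_iff_pos.2 hε
  refine ⟨⟨inferInstance, r, j, fun w => pos w (e w), ?_, ?_, ?_, ?_, ?_⟩⟩
  · intro w hw
    have hle : rankVal L w ≤ ε := rankVal_le (hb w hw)
    by_cases h : w.card ≤ 1
    · simp only [r, if_pos h]; exact max_le hone hle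
    · simp only [r, if_neg h]; exact hle
  · intro v w hv hvw
    by_cases h : w.card ≤ 1
    · have : v = w := Finset.eq_of_subset_of_card_le hvw (h.trans hv.card_pos)
      rw [this]
    · have : r w = rankVal L w := if_neg h
      rw [this]
      exact (rankVal_anti (hb v hv) hvw).trans (hr_le v)
  · intro a
    have : r {a} = max 1 (rankVal L {a}) := if_pos (by simp)
    rw [this]
    exact lt_of_lt_of_le zero_lt_one (le_max_left _ _)
  · exact fun w hw => pos_lt_card (hwit w hw).mem
  · rintro w a ha hka ⟨b, hbw, hkb, hj, hr⟩
    have hw : w.Nonempty := ⟨a, ha⟩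
    have hW := hwit w hw
    obtain rfl : a = e w := pos_injOn w ha hW.mem hka
    have hne : (insert b (w.erase (e w))).Nonempty := Finset.insert_nonempty _ _
    have hW' := hwit _ hne
    have henum := enum_insert_erase ha hbw hkb
    have hbr := hW'.realize
    obtain ⟨h₁, h₂, h₃⟩ : _ ∧ _ ∧ _ := by simpa only [Prod.mk.injEq] using hcode hj
    rw [h₁, henum] at hbr
    by_cases h0 : rankVal L w = 0
    -- Rank `-1`: both sets have the same solutions, countably many, and `a`, `b` the same index.
    · rw [if_pos h0] at h₃
      have h0' : rankVal L (insert b (w.erase (e w))) = 0 := by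
        by_contra hc
        rw [if_neg hc] at h₃
        omega
      rw [if_pos h0'] at h₃
      have hC : C (insert b (w.erase (e w))) = C w := by
        simp only [C, h₁, h₂, henum, Function.update_idem]
      have he : e (insert b (w.erase (e w))) = b := by
        rw [← enum_pos hW'.mem, h₂, henum, Function.update_self]
      rw [hC, he] at h₃
      have hwC : e w ∈ C w := by
        have := hW.realize
        rwa [← Function.update_eq_self (pos w (e w)) (enum w), enum_pos ha] at this
      have hbe : b = e w := hidx (C w) (hW.countable h0) hbr hwC (Nat.succ_injective h₃)
      exact hbw (hbe ▸ ha)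
    -- Rank at least `0`: no solution `b` of the formula satisfies `rk(w ∪ {b}) = rk(w)`.
    · refine hW.not_realize h0 b hbw ?_ hbr
      have hcard : ¬ (insert b w).card ≤ 1 := by
        rw [Finset.card_insert_of_notMem hbw]
        have := hw.card_pos
        omega
      have hrb : r (insert b w) = rankVal L (insert b w) := if_neg hcard
      refine le_antisymm (rankVal_anti (hb w hw) (Finset.subset_insert b w)) ?_
      rw [← hrb, hr]
      exact hr_le w

end ModelSystem

/-! ### Quasi-embeddings -/

section QuasiEmb

variable {X Y Z : Type*} [LinearOrder X] [WellFoundedLT X] [LinearOrder Y] [WellFoundedLT Y]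
  [LinearOrder Z] [WellFoundedLT Z] {ε : Ordinal.{u}} {q : YZRSystem X ε} {s : YZRSystem Y ε}
  {t : YZRSystem Z ε}

theorem IsQuasiEmbOn.mono {w w' : Set X} {φ : X → Y} (h : IsQuasiEmbOn q s w φ) (hw : w' ⊆ w) :
    IsQuasiEmbOn q s w' φ :=
  ⟨h.1.mono hw, fun v hv hvw => h.2 v hv (hvw.trans hw)⟩

theorem IsQuasiEmbOn.comp {w : Set X} {φ : X → Y} {ψ : Y → Z} (hψ : IsQuasiEmbOn s t (φ '' w) ψ)
    (hφ : IsQuasiEmbOn q s w φ) : IsQuasiEmbOn q t w (ψ ∘ φ) := by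
  refine ⟨hψ.1.comp hφ.1 (Set.mapsTo_image φ w), fun v hv hvw => ?_⟩
  obtain ⟨h₁, h₂, h₃⟩ := hφ.2 v hv hvw
  obtain ⟨h₁', h₂', h₃'⟩ := hψ.2 (v.image φ) (hv.image φ)
    (by rw [Finset.coe_image]; exact Set.image_mono hvw)
  rw [← Finset.image_image]
  exact ⟨h₁'.trans h₁, h₂'.trans h₂, fun h => (h₃' (h₁ ▸ h)).trans (h₃ h)⟩

theorem IsQuasiEmbOn.congr {w : Set X} {φ ψ : X → Y} (h : IsQuasiEmbOn q s w φ)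
    (e : Set.EqOn φ ψ w) : IsQuasiEmbOn q s w ψ := by
  refine ⟨h.1.congr e, fun v hv hvw => ?_⟩
  have : v.image ψ = v.image φ := Finset.image_congr fun x hx => (e (hvw hx)).symm
  rw [this]
  exact h.2 v hv hvw

theorem IsQuasiEmbOn.invFunOn [Nonempty X] {w : Set X} {φ : X → Y} (h : IsQuasiEmbOn q s w φ) :
    IsQuasiEmbOn s q (φ '' w) (Function.invFunOn φ w) := by
  have hinv : ∀ y ∈ φ '' w, Function.invFunOn φ w y ∈ w ∧ φ (Function.invFunOn φ w y) = y :=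
    fun y hy => ⟨Function.invFunOn_mem hy, Function.invFunOn_eq hy⟩
  refine ⟨fun x hx y hy hxy => ?_, fun v hv hvw => ?_⟩
  · rw [← (hinv x hx).2, ← (hinv y hy).2] at hxy
    exact (h.1.lt_iff_lt (hinv x hx).1 (hinv y hy).1).1 hxy
  · have hv' : (v.image (Function.invFunOn φ w)).image φ = v := by
      rw [Finset.image_image]
      conv_rhs => rw [← Finset.image_id (s := v)]
      exact Finset.image_congr fun x hx => (hinv x (hvw hx)).2
    obtain ⟨h₁, h₂, h₃⟩ := h.2 (v.image (Function.invFunOn φ w)) (hv.image _) (by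
      rw [Finset.coe_image]
      rintro _ ⟨x, hx, rfl⟩
      exact (hinv x (hvw hx)).1)
    rw [hv'] at h₁ h₂ h₃
    exact ⟨h₁.symm, h₂.symm, fun h => (h₃ (h₁ ▸ h)).symm⟩

/-- The restriction of a system to a nonempty finite set. -/
def YZRSystem.restrict (q : YZRSystem X ε) (w : Finset X) (hw : w.Nonempty) :
    YZRSystem {a // a ∈ w} ε where
  nonempty := hw.to_subtype
  r v := q.r (v.image Subtype.val)
  j v := q.j (v.image Subtype.val)
  k v := q.k (v.image Subtype.val)
  r_le v hv := q.r_le _ (hv.image _)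
  r_anti v v' hv h := q.r_anti _ _ (hv.image _) (Finset.image_subset_image h)
  r_singleton a := by simpa using q.r_singleton a
  k_lt v hv := by
    have := q.k_lt _ (hv.image Subtype.val)
    rwa [Finset.card_image_of_injective _ Subtype.val_injective] at this
  no_twin := by
    have hpos : ∀ (v : Finset {a // a ∈ w}) (b : {a // a ∈ w}),
        pos (v.image Subtype.val) b = pos v b := by
      intro v b
      rw [pos, pos, Finset.filter_image, Finset.card_image_of_injective _ Subtype.val_injective]
      rfl
    rintro v a ha hk ⟨b, hb, hk', hj, hr⟩
    refine q.no_twin (v.image Subtype.val) a (Finset.mem_image_of_mem _ ha)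
      ((hpos v a).trans hk) ⟨b, by simpa using hb, (hpos v b).trans hk', ?_, ?_⟩
    · rwa [Finset.image_insert, Finset.image_erase Subtype.val_injective] at hj
    · rwa [Finset.image_insert] at hr

end QuasiEmb

/-- Every finite part of any system quasi-embeds into a cute one. -/
theorem IsCute.exists_isQuasiEmbOn {ε : Ordinal.{u}} {S : YZRSystem ℕ ε} (hS : IsCute S)
    {Λ : Type u} [LinearOrder Λ] [WellFoundedLT Λ] (s : YZRSystem Λ ε) {w : Finset Λ}
    (hw : w.Nonempty) : ∃ ψ : Λ → ℕ, IsQuasiEmbOn s S (w : Set Λ) ψ := by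
  obtain ⟨φ, hφ, -⟩ := hS {a // a ∈ w} (s.restrict w hw) 0
  let ψ : Λ → ℕ := fun a => if h : a ∈ w then φ ⟨a, h⟩ else 0
  have hψ : ∀ a (h : a ∈ w), ψ a = φ ⟨a, h⟩ := fun a h => dif_pos h
  refine ⟨ψ, fun a ha b hb hab => ?_, fun v hv hvw => ?_⟩
  · rw [hψ a ha, hψ b hb]
    exact hφ.1 trivial trivial hab
  · let v' : Finset {a // a ∈ w} := v.subtype (· ∈ w)
    have h₁ : v'.image Subtype.val = v := by
      ext x
      simp only [v', Finset.mem_image, Finset.mem_subtype]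
      exact ⟨fun ⟨a, ha, e⟩ => e ▸ ha, fun hx => ⟨⟨x, hvw hx⟩, hx, rfl⟩⟩
    have h₂ : v.image ψ = v'.image φ := by
      rw [← h₁, Finset.image_image]
      exact Finset.image_congr fun x _ => hψ x x.2
    have hv' : v'.Nonempty := by
      rw [← h₁] at hv
      exact Finset.image_nonempty.1 hv
    have h := hφ.2 v' hv' (Set.subset_univ _)
    rw [← h₂] at h
    simpa only [YZRSystem.restrict, h₁] using h

/-! ### Extensions of bricks -/

theorem restr_restr {n l l' : ℕ} (h : l ≤ l') (s : BSeq n) : restr l (restr l' s) = restr l s := by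
  funext k
  simp [restr, lt_of_lt_of_le k.2 h]

theorem InitSeg.refl {n : ℕ} (s : BSeq n) : InitSeg s s :=
  ⟨le_rfl, by funext k; simp [restr]⟩

theorem InitSeg.trans {l m n : ℕ} {s : BSeq l} {t : BSeq m} {x : BSeq n} (h : InitSeg s t)
    (h' : InitSeg t x) : InitSeg s x :=
  ⟨h.1.trans h'.1, by rw [← restr_restr h.1, h'.2, h.2]⟩

theorem InitSeg.apply {m n : ℕ} {s : BSeq m} {t : BSeq n} (h : InitSeg s t) {k : ℕ} (hk : k < m)
    (hk' : k < n) : t ⟨k, hk'⟩ = s ⟨k, hk⟩ := by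
  rw [← h.2]
  simp [restr, hk']

theorem initSeg_restr {l n : ℕ} (h : l ≤ n) (s : BSeq n) : InitSeg (restr l s) s := ⟨h, rfl⟩

namespace BrickData

variable {ι : ℕ} {b b' b'' : BrickData ι}

theorem CopyLE.refl {w : Finset ℕ} (hw : w ⊆ b.w) : b.CopyLE w id b :=
  ⟨by simpa using hw, le_rfl, fun _ _ => InitSeg.refl _, fun _ _ _ _ _ _ => ⟨rfl, InitSeg.refl _⟩⟩

theorem CopyLE.mono {w w' : Finset ℕ} {φ : ℕ → ℕ} (h : b.CopyLE w φ b') (hw : w' ⊆ w) :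
    b.CopyLE w' φ b' :=
  ⟨(Finset.image_subset_image hw).trans h.1, h.2.1, fun a ha => h.2.2.1 a (hw ha),
    fun a ha a' ha' => h.2.2.2 a (hw ha) a' (hw ha')⟩

theorem CopyLE.comp {w : Finset ℕ} {φ ψ : ℕ → ℕ} (h : b.CopyLE w φ b')
    (h' : b'.CopyLE (w.image φ) ψ b'') (hφ : Set.InjOn φ w) : b.CopyLE w (ψ ∘ φ) b'' := by
  have hm : ∀ {a}, a ∈ w → φ a ∈ w.image φ := fun ha => Finset.mem_image_of_mem φ ha
  refine ⟨by rw [← Finset.image_image]; exact h'.1, h.2.1.trans h'.2.1,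
    fun a ha => (h.2.2.1 a ha).trans (h'.2.2.1 _ (hm ha)), fun a ha a' ha' hne i => ?_⟩
  obtain ⟨h₁, h₂⟩ := h.2.2.2 a ha a' ha' hne i
  obtain ⟨h₁', h₂'⟩ := h'.2.2.2 _ (hm ha) _ (hm ha') (hφ.ne ha ha' hne) i
  exact ⟨h₁'.trans h₁, h₂.trans h₂'⟩

end BrickData

/-- The bricks `b n` witness the `(c, S)`-controlled amalgamation property of `T`. -/
structure IsAmalgamationSequence {ε : Ordinal.{u}} (S : YZRSystem ℕ ε) {ι : ℕ} (T : ℕ → NodeSet)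
    (c : ℕ → ℕ) (b : ℕ → BrickData ι) : Prop where
  isBrick : ∀ n, (b n).IsBrick S T c
  brickLE : ∀ n, (b n).BrickLE (b (n + 1))
  cover : ∀ a : ℕ, ∃ n, a ∈ (b n).w
  tendsto : Filter.Tendsto (fun n => (b n).n) Filter.atTop Filter.atTop
  amalgamate : ∀ (n : ℕ) (v₀ w : Finset ℕ) (π₀ π₁ : ℕ → ℕ),
    v₀ ⊆ w → w ⊆ (b n).w → 3 ≤ w.card →
    (∀ v ⊆ v₀, ∀ d ∈ w \ v₀, S.r (insert d v) = 0 → S.k (insert d v) ≠ pos v d) →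
    IsQuasiEmbOn S S (w : Set ℕ) π₀ → IsQuasiEmbOn S S (w : Set ℕ) π₁ →
    (∀ a ∈ v₀, π₀ a = π₁ a) → Disjoint ((w \ v₀).image π₀) ((w \ v₀).image π₁) →
    ∃ (K : ℕ) (π : ℕ → ℕ),
      IsQuasiEmbOn S S ((w.image π₀ ∪ w.image π₁ : Finset ℕ) : Set ℕ) π ∧
      (w.image π₀ ∪ w.image π₁).image π ⊆ (b K).w ∧
      (b n).CopyLE w (π ∘ π₀) (b K) ∧ (b n).CopyLE w (π ∘ π₁) (b K)
  extend : ∀ (n : ℕ) (w v : Finset ℕ) (π₀ : ℕ → ℕ),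
    w ⊆ (b n).w → 3 ≤ w.card → IsQuasiEmbOn S S (w : Set ℕ) π₀ → w.image π₀ ⊆ v →
    ∃ (K : ℕ) (π : ℕ → ℕ),
      IsQuasiEmbOn S S (v : Set ℕ) π ∧ v.image π ⊆ (b K).w ∧ (b n).CopyLE w (π ∘ π₀) (b K)

theorem ControlledAmalgamation.exists_sequence {ε : Ordinal.{u}} {S : YZRSystem ℕ ε} {ι : ℕ}
    {T : ℕ → NodeSet} {c : ℕ → ℕ} (h : ControlledAmalgamation S ι T c) :
    ∃ b : ℕ → BrickData ι, IsAmalgamationSequence S T c b := by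
  obtain ⟨b, h₁, h₂, h₃, h₄, h₅, h₆⟩ := h
  exact ⟨b, h₁, h₂, h₃, h₄, h₅, h₆⟩

section

variable {ε : Ordinal.{u}} {S : YZRSystem ℕ ε} {ι : ℕ} {T : ℕ → NodeSet} {c : ℕ → ℕ}
  {b : ℕ → BrickData ι}

theorem IsAmalgamationSequence.copyLE (h : IsAmalgamationSequence S T c b) {m n : ℕ} (hmn : m ≤ n) :
    (b m).CopyLE (b m).w id (b n) := by
  induction n, hmn using Nat.le_induction with
  | base => exact .refl subset_rfl
  | succ n _ ih =>
    refine ih.comp ((h.brickLE n).mono ?_) Function.injective_id.injOn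
    simpa using ih.1

theorem IsAmalgamationSequence.exists_subset (h : IsAmalgamationSequence S T c b) (w : Finset ℕ) :
    ∃ n, w ⊆ (b n).w := by
  induction w using Finset.induction_on with
  | empty => exact ⟨0, by simp⟩
  | insert a w _ ih =>
    obtain ⟨m, hm⟩ := ih
    obtain ⟨n, hn⟩ := h.cover a
    refine ⟨max m n, Finset.insert_subset ?_ (hm.trans ?_)⟩
    · simpa using (h.copyLE (le_max_right m n)).1 (Finset.mem_image_of_mem id hn)
    · simpa using (h.copyLE (le_max_left m n)).1

end

/-! ### Finding a root -/

theorem exists_uncountable_fiber {I J : Type*} [Countable J] {A : Set I} (hA : ¬ A.Countable)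
    (f : I → J) : ∃ j, ¬ (A ∩ f ⁻¹' {j}).Countable := by
  by_contra h
  push Not at h
  refine hA ((Set.countable_iUnion h).mono fun x hx => ?_)
  exact Set.mem_iUnion.2 ⟨f x, hx, rfl⟩

/-- A form of the `Δ`-system lemma: uncountably many functions on a finite set contain uncountably
many that agree on a subset `v` and whose images of the complement of `v` are pairwise disjoint. -/
theorem exists_uncountable_root {I X Λ : Type*} [DecidableEq X] {A : Set I} (hA : ¬ A.Countable)
    (W : Finset X) (f : I → X → Λ) :
    ∃ v ⊆ W, ∃ B ⊆ A, ¬ B.Countable ∧ (∀ p ∈ B, ∀ q ∈ B, ∀ x ∈ v, f p x = f q x) ∧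
      B.Pairwise fun p q => ∀ x ∈ W \ v, ∀ y ∈ W \ v, f p x ≠ f q y := by
  classical
  -- The root is a maximal set on which uncountably many of the functions agree.
  let V := W.powerset.filter fun v =>
    ∃ A' ⊆ A, ¬ A'.Countable ∧ ∀ p ∈ A', ∀ q ∈ A', ∀ x ∈ v, f p x = f q x
  have hV : V.Nonempty := ⟨∅, by
    simp only [V, Finset.mem_filter, Finset.empty_mem_powerset, true_and]
    exact ⟨A, subset_rfl, hA, by simp⟩⟩
  obtain ⟨v, hv, hmax⟩ := Finset.exists_max_image V Finset.card hV
  obtain ⟨hvW, A', hA'A, hA', hagree⟩ := Finset.mem_filter.1 hv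
  have hvW := Finset.mem_powerset.1 hvW
  have hfib : ∀ x ∈ W \ v, ∀ a, {p ∈ A' | f p x = a}.Countable := by
    intro x hx a
    by_contra hc
    obtain ⟨hxW, hxv⟩ := Finset.mem_sdiff.1 hx
    have : insert x v ∈ V := by
      refine Finset.mem_filter.2 ⟨Finset.mem_powerset.2 (Finset.insert_subset hxW hvW),
        _, (Set.sep_subset _ _).trans hA'A, hc, fun p hp q hq y hy => ?_⟩
      rcases Finset.mem_insert.1 hy with rfl | hy
      · exact hp.2.trans hq.2.symm
      · exact hagree p hp.1 q hq.1 y hy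
    have := hmax _ this
    rw [Finset.card_insert_of_notMem hxv] at this
    omega
  let R : I → I → Prop := fun p q => ∀ x ∈ W \ v, ∀ y ∈ W \ v, f p x ≠ f q y
  obtain ⟨B, hB⟩ := zorn_subset {B : Set I | B ⊆ A' ∧ B.Pairwise R} fun C hC hchain =>
    ⟨⋃₀ C, ⟨Set.sUnion_subset fun B hB => (hC hB).1,
      (Set.pairwise_sUnion hchain.directedOn).2 fun B hB => (hC hB).2⟩,
      fun B hB => Set.subset_sUnion_of_mem hB⟩
  refine ⟨v, hvW, B, hB.prop.1.trans hA'A, fun hc => hA' ?_,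
    fun p hp q hq => hagree p (hB.prop.1 hp) q (hB.prop.1 hq), hB.prop.2⟩
  -- By maximality every function meets one of the countably many values taken in `B`.
  have hcov : A' ⊆ B ∪ ⋃ q ∈ B, ⋃ x ∈ W \ v, ⋃ y ∈ W \ v, {p ∈ A' | f p x = f q y} := by
    intro p hp
    by_contra hn
    simp only [Set.mem_union, Set.mem_iUnion, not_or, not_exists] at hn
    obtain ⟨hpB, hn⟩ := hn
    have hR : ∀ q ∈ B, ∀ x ∈ W \ v, ∀ y ∈ W \ v, f p x ≠ f q y := fun q hq x hx y hy e =>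
      hn q hq x hx y hy ⟨hp, e⟩
    have hins : insert p B ∈ {B : Set I | B ⊆ A' ∧ B.Pairwise R} :=
      ⟨Set.insert_subset hp hB.prop.1, Set.pairwise_insert.2 ⟨hB.prop.2, fun q hq _ =>
        ⟨hR q hq, fun x hx y hy e => hR q hq y hy x hx e.symm⟩⟩⟩
    exact hpB (hB.le_of_ge hins (Set.subset_insert p B) (Set.mem_insert p B))
  refine (hc.union (hc.biUnion fun q _ => ?_)).mono hcov
  exact (Finset.countable_toSet _).biUnion fun x hx =>
    (Finset.countable_toSet _).biUnion fun y _ => hfib x hx _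

/-! ### The forcing notion -/

section Forcing

variable {Λ : Type u} [LinearOrder Λ] [WellFoundedLT Λ] {ε : Ordinal.{u}} {ι : ℕ}

/-- A condition is a copy, along a quasi-embedding `φ` of the finite set `w` into `S`, of the
restriction of the brick `b N` to `φ[w]`.  The values of `φ` off `w` are normalized to `0`. -/
@[ext]
structure Condition (s : YZRSystem Λ ε) (S : YZRSystem ℕ ε) (b : ℕ → BrickData ι) where
  w : Finset Λ
  N : ℕ
  φ : Λ → ℕ
  three_le : 3 ≤ w.card
  quasiEmb : IsQuasiEmbOn s S (w : Set Λ) φ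
  image_subset : w.image φ ⊆ (b N).w
  eq_zero : ∀ a ∉ w, φ a = 0

namespace Condition

variable {s : YZRSystem Λ ε} {S : YZRSystem ℕ ε} {b : ℕ → BrickData ι}

/-- The support of a condition inside its brick. -/
def range (p : Condition s S b) : Finset ℕ := p.w.image p.φ

theorem mem_range (p : Condition s S b) {a : Λ} (ha : a ∈ p.w) : p.φ a ∈ p.range :=
  Finset.mem_image_of_mem _ ha

theorem mem_brick (p : Condition s S b) {a : Λ} (ha : a ∈ p.w) : p.φ a ∈ (b p.N).w :=
  p.image_subset (p.mem_range ha)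

theorem injOn (p : Condition s S b) : Set.InjOn p.φ p.w := p.quasiEmb.1.injOn

theorem three_le_card_range (p : Condition s S b) : 3 ≤ p.range.card := by
  rw [range, Finset.card_image_of_injOn p.injOn]
  exact p.three_le

/-- The copy of a brick given by `q` extends the one given by `p`. -/
def Extends (p q : Condition s S b) : Prop :=
  p.w ⊆ q.w ∧ ∃ θ : ℕ → ℕ, (∀ a ∈ p.w, θ (p.φ a) = q.φ a) ∧ (b p.N).CopyLE p.range θ (b q.N)

theorem Extends.refl (p : Condition s S b) : Extends p p :=
  ⟨subset_rfl, id, fun _ _ => rfl, .refl p.image_subset⟩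

theorem Extends.trans {p q r : Condition s S b} (h : Extends p q) (h' : Extends q r) :
    Extends p r := by
  obtain ⟨hw, θ, hθ, hc⟩ := h
  obtain ⟨hw', θ', hθ', hc'⟩ := h'
  refine ⟨hw.trans hw', θ' ∘ θ, fun a ha => ?_, hc.comp (hc'.mono ?_) ?_⟩
  · rw [Function.comp_apply, hθ a ha, hθ' a (hw ha)]
  · rw [range, Finset.image_image]
    intro x hx
    obtain ⟨a, ha, rfl⟩ := Finset.mem_image.1 hx
    rw [Function.comp_apply, hθ a ha]
    exact q.mem_range (hw ha)
  · intro x hx y hy hxy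
    obtain ⟨a, ha, rfl⟩ := Finset.mem_image.1 hx
    obtain ⟨a', ha', rfl⟩ := Finset.mem_image.1 hy
    simp only [hθ a ha, hθ a' ha'] at hxy
    rw [q.injOn (hw ha) (hw ha') hxy]

/-- A proper extension also has to use a later brick.  This makes the relation antisymmetric, and as
a condition can be moved to a later brick nothing is lost. -/
instance : PartialOrder (Condition s S b) where
  le p q := p = q ∨ p.N < q.N ∧ Extends p q
  le_refl _ := Or.inl rfl
  le_trans := by
    rintro p q r (rfl | h) (rfl | h')
    · exact Or.inl rfl
    · exact Or.inr h'
    · exact Or.inr h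
    · exact Or.inr ⟨h.1.trans h'.1, h.2.trans h'.2⟩
  le_antisymm := by
    rintro p q (rfl | h) (h' | h')
    · rfl
    · rfl
    · exact h'.symm
    · exact (lt_asymm h.1 h'.1).elim

theorem Extends.of_le {p q : Condition s S b} (h : p ≤ q) : Extends p q :=
  h.elim (fun e => e ▸ Extends.refl p) fun h => h.2

section Values

variable {p q : Condition s S b} {a a' : Λ}

theorem Extends.le_n (h : Extends p q) : (b p.N).n ≤ (b q.N).n := by
  obtain ⟨-, θ, -, hc⟩ := h
  exact hc.2.1

theorem Extends.initSeg_η (h : Extends p q) (ha : a ∈ p.w) :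
    InitSeg ((b p.N).η (p.φ a)) ((b q.N).η (q.φ a)) := by
  obtain ⟨-, θ, hθ, hc⟩ := h
  rw [← hθ a ha]
  exact hc.2.2.1 _ (p.mem_range ha)

theorem Extends.h_eq (h : Extends p q) (ha : a ∈ p.w) (ha' : a' ∈ p.w) (hne : a ≠ a')
    (i : Fin ι) : (b q.N).h i (q.φ a) (q.φ a') = (b p.N).h i (p.φ a) (p.φ a') := by
  obtain ⟨-, θ, hθ, hc⟩ := h
  rw [← hθ a ha, ← hθ a' ha']
  exact (hc.2.2.2 _ (p.mem_range ha) _ (p.mem_range ha') (p.injOn.ne ha ha' hne) i).1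

theorem Extends.initSeg_g (h : Extends p q) (ha : a ∈ p.w) (ha' : a' ∈ p.w) (hne : a ≠ a')
    (i : Fin ι) : InitSeg ((b p.N).g i (p.φ a) (p.φ a')) ((b q.N).g i (q.φ a) (q.φ a')) := by
  obtain ⟨-, θ, hθ, hc⟩ := h
  rw [← hθ a ha, ← hθ a' ha']
  exact (hc.2.2.2 _ (p.mem_range ha) _ (p.mem_range ha') (p.injOn.ne ha ha' hne) i).2

end Values

open Classical in
/-- The condition on `w` given by a quasi-embedding. -/
noncomputable def ofQuasiEmb (w : Finset Λ) (N : ℕ) (ψ : Λ → ℕ) (hw : 3 ≤ w.card)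
    (hψ : IsQuasiEmbOn s S (w : Set Λ) ψ) (hN : w.image ψ ⊆ (b N).w) : Condition s S b where
  w := w
  N := N
  φ a := if a ∈ w then ψ a else 0
  three_le := hw
  quasiEmb := hψ.congr fun a ha => (if_pos ha).symm
  image_subset := by
    have : w.image (fun a => if a ∈ w then ψ a else 0) = w.image ψ :=
      Finset.image_congr fun a ha => if_pos ha
    rwa [this]
  eq_zero a ha := if_neg ha

theorem ofQuasiEmb_φ {w : Finset Λ} {N : ℕ} {ψ : Λ → ℕ} {hw : 3 ≤ w.card}
    {hψ : IsQuasiEmbOn s S (w : Set Λ) ψ} {hN : w.image ψ ⊆ (b N).w} {a : Λ} (ha : a ∈ w) :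
    (ofQuasiEmb w N ψ hw hψ hN).φ a = ψ a := if_pos ha

/-- In the system `s`, the element in position `k w` of a set `w` with `r w = 0` is determined by
the other elements of `w` and `j w`: two quasi-embeddings that agree on the others and induce the
same value of `j` agree on it. -/
theorem eq_of_quasiEmb {v : Finset ℕ} {d : ℕ} {f g : ℕ → Λ} (hd : d ∉ v)
    (hf : IsQuasiEmbOn S s ((insert d v : Finset ℕ) : Set ℕ) f)
    (hg : IsQuasiEmbOn S s ((insert d v : Finset ℕ) : Set ℕ) g)
    (hfg : ∀ x ∈ v, f x = g x) (hj : s.j ((insert d v).image f) = s.j ((insert d v).image g))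
    (hr : S.r (insert d v) = 0) (hk : S.k (insert d v) = pos v d) : f d = g d := by
  by_contra hne
  wlog hlt : g d < f d generalizing f g with H
  · exact H hg hf (fun x hx => (hfg x hx).symm) hj.symm (Ne.symm hne)
      (lt_of_le_of_ne (not_lt.1 hlt) hne)
  have hdd : d ∈ insert d v := Finset.mem_insert_self d v
  have himg : v.image f = v.image g := Finset.image_congr fun x hx => hfg x hx
  have hfd : f d ∉ v.image f := by
    intro h
    obtain ⟨x, hx, e⟩ := Finset.mem_image.1 h
    exact hd (hf.1.injOn (Finset.mem_insert_of_mem hx) hdd e ▸ hx)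
  have hgd : g d ∉ v.image f := by
    intro h
    obtain ⟨x, hx, e⟩ := Finset.mem_image.1 h
    rw [hfg x hx] at e
    exact hd (hg.1.injOn (Finset.mem_insert_of_mem hx) hdd e ▸ hx)
  have hne' : (insert d v).Nonempty := Finset.insert_nonempty d v
  obtain ⟨hr', hk', -⟩ := hf.2 _ hne' subset_rfl
  have hpos : pos (insert d v) d = pos v d := pos_insert_of_le le_rfl
  have hmem : f d ∈ (insert d v).image f := Finset.mem_image_of_mem f hdd
  have hr0 : s.r ((insert d v).image f) = 0 := hr'.trans hr
  refine s.no_twin ((insert d v).image f) (f d) hmem ?_ ⟨g d, ?_, ?_, ?_, ?_⟩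
  · rw [pos_image hf.1 hdd, hk', hk, hpos]
  · rw [Finset.image_insert, Finset.mem_insert, not_or]
    exact ⟨fun e => hne e.symm, hgd⟩
  · have hgpos := pos_image hg.1 hdd
    rw [Finset.image_insert, pos_insert_of_le le_rfl] at hgpos
    rw [hk', hk, Finset.image_insert, pos_insert_of_le hlt.le, himg, hgpos, hpos]
  · rw [hj]
    congr 1
    rw [Finset.image_insert, Finset.image_insert, Finset.erase_insert hfd, himg]
  · rw [hr0]
    exact nonpos_iff_eq_zero.1 (hr0 ▸ s.r_anti _ _ ⟨_, hmem⟩ (Finset.subset_insert _ _))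

variable {T : ℕ → NodeSet} {c : ℕ → ℕ}

/-- An extension, moved to a later brick, is an upper bound in the forcing notion. -/
theorem exists_upperBound (hb : IsAmalgamationSequence S T c b) (p : Condition s S b) (M : ℕ) :
    ∃ q : Condition s S b, q.w = p.w ∧ M ≤ q.N ∧ ∀ r : Condition s S b, Extends r p → r.N < M →
      r ≤ q := by
  have hc := hb.copyLE (le_max_right M p.N)
  have hsub : (b p.N).w ⊆ (b (max M p.N)).w := by simpa using hc.1
  let q : Condition s S b := { p with
    N := max M p.N
    image_subset := p.image_subset.trans hsub }
  have hpq : Extends p q := ⟨subset_rfl, id, fun _ _ => rfl, hc.mono p.image_subset⟩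
  exact ⟨q, rfl, le_max_left _ _, fun r hr hM =>
    Or.inr ⟨hM.trans_le (le_max_left _ _), hr.trans hpq⟩⟩

theorem compat_of_extends (hb : IsAmalgamationSequence S T c b) {p q r : Condition s S b}
    (hp : Extends p r) (hq : Extends q r) : Compat p q := by
  obtain ⟨t, -, -, ht⟩ := exists_upperBound hb r (max p.N q.N + 1)
  exact ⟨t, ht p hp (by omega), ht q hq (by omega)⟩

variable [Nonempty Λ]

/-- The inverse of the quasi-embedding of a condition. -/
noncomputable def inv (p : Condition s S b) : ℕ → Λ := Function.invFunOn p.φ p.w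

theorem inv_φ (p : Condition s S b) {a : Λ} (ha : a ∈ p.w) : p.inv (p.φ a) = a :=
  p.injOn.leftInvOn_invFunOn ha

theorem quasiEmb_inv (p : Condition s S b) : IsQuasiEmbOn S s (p.range : Set ℕ) p.inv := by
  rw [range, Finset.coe_image]
  exact p.quasiEmb.invFunOn

theorem image_inv (p : Condition s S b) : p.range.image p.inv = p.w := by
  rw [range, Finset.image_image]
  conv_rhs => rw [← Finset.image_id (s := p.w)]
  exact Finset.image_congr fun a ha => p.inv_φ ha

/-- A quasi-embedding `ψ` of a larger set `w`, composed with a `π` along which the brick of `p` is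
copied, gives an extension of `p`. -/
theorem extends_ofQuasiEmb (p : Condition s S b) {w : Finset Λ} (hpw : p.w ⊆ w) {ψ : Λ → ℕ}
    {π : ℕ → ℕ} {K : ℕ} (hw : 3 ≤ w.card) (h : IsQuasiEmbOn s S (w : Set Λ) (π ∘ ψ))
    (hK : w.image (π ∘ ψ) ⊆ (b K).w)
    (hc : (b p.N).CopyLE p.range (π ∘ (ψ ∘ p.inv)) (b K)) :
    Extends p (ofQuasiEmb w K (π ∘ ψ) hw h hK) :=
  ⟨hpw, _, fun a ha => by
    rw [ofQuasiEmb_φ (hpw ha), Function.comp_apply, Function.comp_apply, p.inv_φ ha,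
      Function.comp_apply], hc⟩

/-! ### Density -/

theorem exists_extends_mem (hS : IsCute S) (hb : IsAmalgamationSequence S T c b)
    (p : Condition s S b) (a : Λ) : ∃ q : Condition s S b, Extends p q ∧ a ∈ q.w := by
  have hpw : p.w ⊆ insert a p.w := Finset.subset_insert a p.w
  obtain ⟨ψ, hψ⟩ := hS.exists_isQuasiEmbOn s (Finset.insert_nonempty a p.w)
  have hinv : p.inv '' (p.range : Set ℕ) = p.w := by rw [← Finset.coe_image, p.image_inv]
  obtain ⟨K, π, hπ, hK, hc⟩ := hb.extend p.N p.range ((insert a p.w).image ψ) (ψ ∘ p.inv)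
    p.image_subset p.three_le_card_range
    (IsQuasiEmbOn.comp (hψ.mono (by rw [hinv]; exact_mod_cast hpw)) p.quasiEmb_inv)
    (by rw [← Finset.image_image, p.image_inv]; exact Finset.image_subset_image hpw)
  rw [Finset.image_image] at hK
  rw [Finset.coe_image] at hπ
  have hcard := p.three_le.trans (Finset.card_le_card hpw)
  exact ⟨_, p.extends_ofQuasiEmb hpw hcard (hπ.comp hψ) hK hc, Finset.mem_insert_self a p.w⟩

theorem exists_le_mem (hS : IsCute S) (hb : IsAmalgamationSequence S T c b)
    (p : Condition s S b) (a a' : Λ) (n : ℕ) :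
    ∃ q, p ≤ q ∧ a ∈ q.w ∧ a' ∈ q.w ∧ n ≤ (b q.N).n := by
  obtain ⟨q, hpq, ha⟩ := exists_extends_mem hS hb p a
  obtain ⟨r, hqr, ha'⟩ := exists_extends_mem hS hb q a'
  obtain ⟨M, hM⟩ := Filter.eventually_atTop.1 (hb.tendsto.eventually_ge_atTop n)
  obtain ⟨t, ht, hMt, hle⟩ := exists_upperBound hb r (max M (p.N + 1))
  refine ⟨t, hle p (hpq.trans hqr) (by omega), ?_, ?_, hM _ (by omega)⟩
  · rw [ht]
    exact hqr.1 ha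
  · rwa [ht]

/-! ### The Knaster property -/

/-- Two conditions are compatible if they are copies of the same part of the same brick, overlap
only in places that correspond to each other, and induce the same values of `j`. -/
theorem compat_of_root (hS : IsCute S) (hb : IsAmalgamationSequence S T c b)
    {p q : Condition s S b} (hN : p.N = q.N) (hrange : p.range = q.range)
    (hj : ∀ v ⊆ p.range, s.j (v.image p.inv) = s.j (v.image q.inv)) {v₀ : Finset ℕ}
    (hv₀ : v₀ ⊆ p.range) (hroot : ∀ x ∈ v₀, p.inv x = q.inv x)
    (hdisj : ∀ x ∈ p.range \ v₀, ∀ y ∈ p.range \ v₀, p.inv x ≠ q.inv y) : Compat p q := by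
  have hpw : p.w ⊆ p.w ∪ q.w := Finset.subset_union_left
  have hqw : q.w ⊆ p.w ∪ q.w := Finset.subset_union_right
  have hpinv : p.inv '' (p.range : Set ℕ) = p.w := by rw [← Finset.coe_image, p.image_inv]
  have hqinv : q.inv '' (p.range : Set ℕ) = q.w := by
    rw [hrange, ← Finset.coe_image, q.image_inv]
  have hq : IsQuasiEmbOn S s (p.range : Set ℕ) q.inv := hrange ▸ q.quasiEmb_inv
  have hcard : 3 ≤ (p.w ∪ q.w).card := p.three_le.trans (Finset.card_le_card hpw)
  obtain ⟨ψ, hψ⟩ := hS.exists_isQuasiEmbOn s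
    (Finset.card_pos.1 (Nat.lt_of_lt_of_le (by norm_num) hcard))
  have himg : p.range.image (ψ ∘ p.inv) ∪ p.range.image (ψ ∘ q.inv) = (p.w ∪ q.w).image ψ := by
    rw [← Finset.image_image, ← Finset.image_image, p.image_inv, hrange, q.image_inv,
      Finset.image_union]
  obtain ⟨K, π, hπ, hK, hcp, hcq⟩ := hb.amalgamate p.N v₀ p.range (ψ ∘ p.inv) (ψ ∘ q.inv) hv₀
    p.image_subset p.three_le_card_range
    (by
      intro v hv d hd hr hk
      obtain ⟨hdr, hdv⟩ := Finset.mem_sdiff.1 hd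
      have hsub : insert d v ⊆ p.range := Finset.insert_subset hdr (hv.trans hv₀)
      have hsub' : ((insert d v : Finset ℕ) : Set ℕ) ⊆ p.range := by exact_mod_cast hsub
      exact hdisj d hd d hd (eq_of_quasiEmb (fun h => hdv (hv h)) (p.quasiEmb_inv.mono hsub')
        (hq.mono hsub') (fun x hx => hroot x (hv hx)) (hj _ hsub) hr hk))
    (IsQuasiEmbOn.comp (hψ.mono (by rw [hpinv]; exact_mod_cast hpw)) p.quasiEmb_inv)
    (IsQuasiEmbOn.comp (hψ.mono (by rw [hqinv]; exact_mod_cast hqw)) hq)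
    (fun x hx => congrArg ψ (hroot x hx))
    (by
      refine Finset.disjoint_left.2 fun z hz hz' => ?_
      obtain ⟨x, hx, rfl⟩ := Finset.mem_image.1 hz
      obtain ⟨y, hy, e⟩ := Finset.mem_image.1 hz'
      have hxw : p.inv x ∈ p.w := by
        rw [← p.image_inv]
        exact Finset.mem_image_of_mem _ (Finset.mem_sdiff.1 hx).1
      have hyw : q.inv y ∈ q.w := by
        rw [← q.image_inv, ← hrange]
        exact Finset.mem_image_of_mem _ (Finset.mem_sdiff.1 hy).1
      exact hdisj x hx y hy (hψ.1.injOn (hqw hyw) (hpw hxw) e).symm)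
  rw [himg, Finset.coe_image] at hπ
  rw [himg, Finset.image_image] at hK
  rw [hN, hrange] at hcq
  exact compat_of_extends hb (p.extends_ofQuasiEmb hpw hcard (hπ.comp hψ) hK hcp)
    (q.extends_ofQuasiEmb hqw hcard (hπ.comp hψ) hK hcq)

theorem isKnaster (hS : IsCute S) (hb : IsAmalgamationSequence S T c b) :
    IsKnaster (Condition s S b) := by
  intro A hA
  -- The type of a condition: the number of its brick, its place there, and its values of `j`.
  let type : Condition s S b → ℕ × Finset ℕ × Finset (Finset ℕ × ℕ) := fun p =>
    (p.N, p.range, p.range.powerset.image fun v => (v, s.j (v.image p.inv)))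
  obtain ⟨⟨N, W, J⟩, hA'⟩ := exists_uncountable_fiber hA type
  obtain ⟨v₀, hv₀, B, hB, hBc, hroot, hdisj⟩ := exists_uncountable_root hA' W inv
  have htype : ∀ p ∈ B, p.N = N ∧ p.range = W ∧
      (p.range.powerset.image fun v => (v, s.j (v.image p.inv))) = J := fun p hp => by
    simpa only [type, Set.mem_preimage, Set.mem_singleton_iff, Prod.mk.injEq] using (hB hp).2
  refine ⟨B, hB.trans Set.inter_subset_left, hBc, fun p hp q hq hne => ?_⟩
  obtain ⟨hNp, hWp, hJp⟩ := htype p hp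
  obtain ⟨hNq, hWq, hJq⟩ := htype q hq
  refine compat_of_root hS hb (hNp.trans hNq.symm) (hWp.trans hWq.symm) (fun v hv => ?_)
    (hWp ▸ hv₀) (hroot p hp q hq) (hWp ▸ hdisj hp hq hne)
  have hmem : (v, s.j (v.image p.inv)) ∈ J :=
    hJp ▸ Finset.mem_image.2 ⟨v, Finset.mem_powerset.2 hv, rfl⟩
  rw [← hJq] at hmem
  obtain ⟨v', -, e⟩ := Finset.mem_image.1 hmem
  obtain ⟨rfl, e⟩ := Prod.mk.inj e
  exact e.symm

end Condition

theorem IsKnaster.isCCC {P : Type u} [PartialOrder P] (h : IsKnaster P) : IsCCC P := by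
  intro A hA
  by_contra hc
  obtain ⟨B, hBA, hB, hcomp⟩ := h A hc
  have hnt : B.Nontrivial := by
    by_contra hn
    exact hB (Set.not_nontrivial_iff.1 hn).finite.countable
  obtain ⟨p, hp, q, hq, hne⟩ := hnt
  exact hA (hBA hp) (hBA hq) hne (hcomp hp hq hne)

namespace Condition

/-! ### The size of the forcing notion -/

variable {s : YZRSystem Λ ε} {S : YZRSystem ℕ ε} {b : ℕ → BrickData ι} {T : ℕ → NodeSet}
  {c : ℕ → ℕ}

theorem nonempty [Infinite Λ] (hS : IsCute S) (hb : IsAmalgamationSequence S T c b) :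
    Nonempty (Condition s S b) := by
  obtain ⟨w, hw⟩ := Infinite.exists_subset_card_eq Λ 3
  have hne : w.Nonempty := Finset.card_pos.1 (by omega)
  obtain ⟨ψ, hψ⟩ := hS.exists_isQuasiEmbOn s hne
  obtain ⟨N, hN⟩ := hb.exists_subset (w.image ψ)
  exact ⟨ofQuasiEmb w N ψ hw.ge hψ hN⟩

theorem mk_eq [Infinite Λ] (hS : IsCute S) (hb : IsAmalgamationSequence S T c b) :
    #(Condition s S b) = #Λ := by
  apply le_antisymm
  · -- A condition is determined by the number of its brick and the graph of its quasi-embedding.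
    let f : Condition s S b → ℕ × Finset (Λ × ℕ) := fun p => (p.N, p.w.image fun a => (a, p.φ a))
    have hf : Function.Injective f := by
      intro p q hpq
      obtain ⟨hN, hg⟩ := Prod.mk.inj hpq
      have hmem : ∀ a n, (a ∈ p.w ∧ p.φ a = n) ↔ (a ∈ q.w ∧ q.φ a = n) := fun a n => by
        simpa using congrArg (fun F => (a, n) ∈ F) hg
      have hw : p.w = q.w := Finset.ext fun a =>
        ⟨fun h => ((hmem a _).1 ⟨h, rfl⟩).1, fun h => ((hmem a _).2 ⟨h, rfl⟩).1⟩
      refine Condition.ext hw hN (funext fun a => ?_)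
      by_cases ha : a ∈ p.w
      · exact ((hmem a _).1 ⟨ha, rfl⟩).2.symm
      · rw [p.eq_zero a ha, q.eq_zero a (hw ▸ ha)]
    refine (Cardinal.mk_le_of_injective (f := fun p => ULift.up.{u} (f p))
      (ULift.up_injective.comp hf)).trans ?_
    simp [Cardinal.aleph0_le_mk]
  · -- Every element of `Λ` belongs to one of the finite sets `p.w`.
    obtain ⟨p₀⟩ := nonempty (s := s) hS hb
    have hinf : Infinite (Condition s S b) := by
      by_contra hfin
      rw [not_infinite_iff_finite] at hfin
      obtain ⟨M, hM⟩ := (Set.finite_range (N : Condition s S b → ℕ)).bddAbove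
      obtain ⟨q, -, hq, -⟩ := exists_upperBound hb p₀ (M + 1)
      have := hM (Set.mem_range_self q)
      omega
    have hcov : ∀ a : Λ, ∃ p : Condition s S b, a ∈ p.w := fun a => by
      obtain ⟨q, -, hq⟩ := exists_extends_mem hS hb p₀ a
      exact ⟨q, hq⟩
    choose F hF using hcov
    let g : Λ → Condition s S b × ℕ := fun a => (F a, (F a).φ a)
    have hg : Function.Injective g := by
      intro a a' h
      obtain ⟨h₁, h₂⟩ := Prod.mk.inj h
      rw [← h₁] at h₂
      exact (F a).injOn (hF a) (h₁ ▸ hF a') h₂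
    refine (Cardinal.mk_le_of_injective hg).trans ?_
    simp [Cardinal.aleph0_le_mk]

end Condition

end Forcing

/-! ### Bricks as approximations -/

namespace BrickData.IsBrick

variable {ε : Ordinal.{u}} {S : YZRSystem ℕ ε} {ι : ℕ} {T : ℕ → NodeSet} {c : ℕ → ℕ}
  {b : BrickData ι} {x y : ℕ}

theorem η_ne (hb : b.IsBrick S T c) (hx : x ∈ b.w) (hy : y ∈ b.w) (hne : x ≠ y) :
    b.η x ≠ b.η y := fun e =>
  hne (congrArg Subtype.val (hb.lin_indep.injective (a₁ := ⟨x, hx⟩) (a₂ := ⟨y, hy⟩) e))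

theorem g_mem (hb : b.IsBrick S T c) (hx : x ∈ b.w) (hy : y ∈ b.w) (hne : x ≠ y) (i : Fin ι) :
    b.g i x y ∈ T (b.h i x y) b.n := by
  obtain ⟨m, hm, hu, he⟩ := hb.top_mem
  have := hm.g_mem (b.η x) (hu ▸ Finset.mem_image_of_mem _ hx) (b.η y)
    (hu ▸ Finset.mem_image_of_mem _ hy) (hb.η_ne hx hy hne) i
  rwa [(he x hx y hy hne i).1, (he x hx y hy hne i).2] at this

theorem add_eq (hb : b.IsBrick S T c) (hx : x ∈ b.w) (hy : y ∈ b.w) (hne : x ≠ y) (i : Fin ι) :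
    b.η x + b.g i x y = b.η y + b.g i y x := by
  obtain ⟨m, hm, hu, he⟩ := hb.top_mem
  have := hm.add_eq (b.η x) (hu ▸ Finset.mem_image_of_mem _ hx) (b.η y)
    (hu ▸ Finset.mem_image_of_mem _ hy) (hb.η_ne hx hy hne) i
  rwa [(he x hx y hy hne i).2, (he y hy x hx hne.symm i).2] at this

theorem g_injective (hb : b.IsBrick S T c) (hx : x ∈ b.w) (hy : y ∈ b.w) (hne : x ≠ y) :
    Function.Injective (Sum.elim (fun i : Fin ι => b.g i x y) fun i : Fin ι => b.g i y x) := by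
  obtain ⟨m, hm, hu, he⟩ := hb.top_mem
  have := hm.no_rep (b.η x) (hu ▸ Finset.mem_image_of_mem _ hx) (b.η y)
    (hu ▸ Finset.mem_image_of_mem _ hy) (hb.η_ne hx hy hne)
  simpa only [(he x hx y hy hne _).2, (he y hy x hx hne.symm _).2] using this

end BrickData.IsBrick

/-! ### The generic sequence and its overlaps -/

section Generic

variable {Λ : Type u} [LinearOrder Λ] [WellFoundedLT Λ] [Nonempty Λ] {ε : Ordinal.{u}} {ι : ℕ}
  {s : YZRSystem Λ ε} {S : YZRSystem ℕ ε} {b : ℕ → BrickData ι} {T : ℕ → NodeSet} {c : ℕ → ℕ}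

namespace Condition

/-- The generic real `η_a`, the union of the sequences `η_a` of the conditions in the generic
filter. -/
def etaReal (hS : IsCute S) (hb : IsAmalgamationSequence S T c b) (a : Λ) :
    GenericReal (Condition s S b) where
  val p n i := a ∈ p.w ∧ ∃ hn : n < (b p.N).n, (b p.N).η (p.φ a) ⟨n, hn⟩ = i
  mono := by
    rintro p q n i hpq ⟨ha, hn, rfl⟩
    have he := Extends.of_le hpq
    exact ⟨he.1 ha, hn.trans_le he.le_n, (he.initSeg_η ha).apply hn _⟩
  uniq := by
    rintro p n _ _ ⟨_, _, rfl⟩ ⟨_, _, rfl⟩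
    rfl
  dense p n := by
    obtain ⟨q, hpq, ha, -, hn⟩ := exists_le_mem hS hb p a a (n + 1)
    exact ⟨q, hpq, _, ha, hn, rfl⟩

/-- The generic branch `g_i(a, a')` for `a ≠ a'`. -/
def gReal (hS : IsCute S) (hb : IsAmalgamationSequence S T c b) {a a' : Λ} (hne : a ≠ a')
    (i : Fin ι) : GenericReal (Condition s S b) where
  val p n t := (a ∈ p.w ∧ a' ∈ p.w) ∧
    ∃ hn : n < (b p.N).n, (b p.N).g i (p.φ a) (p.φ a') ⟨n, hn⟩ = t
  mono := by
    rintro p q n t hpq ⟨⟨ha, ha'⟩, hn, rfl⟩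
    have he := Extends.of_le hpq
    exact ⟨⟨he.1 ha, he.1 ha'⟩, hn.trans_le he.le_n, (he.initSeg_g ha ha' hne i).apply hn _⟩
  uniq := by
    rintro p n _ _ ⟨_, _, rfl⟩ ⟨_, _, rfl⟩
    rfl
  dense p n := by
    obtain ⟨q, hpq, ha, ha', hn⟩ := exists_le_mem hS hb p a a' (n + 1)
    exact ⟨q, hpq, _, ⟨ha, ha'⟩, hn, rfl⟩

/-- The `2ι` branches `g_i(a, a')` and `g_i(a', a)`. -/
def gFamily (hS : IsCute S) (hb : IsAmalgamationSequence S T c b) {a a' : Λ} (hne : a ≠ a') :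
    Fin ι ⊕ Fin ι → GenericReal (Condition s S b) :=
  Sum.elim (gReal hS hb hne) (gReal hS hb hne.symm)

/-- The `2ι` elements `η_a + g_i(a, a')` and `η_a + g_i(a', a)` of `(η_a + B) ∩ (η_{a'} + B)`. -/
def zFamily (hS : IsCute S) (hb : IsAmalgamationSequence S T c b) {a a' : Λ} (hne : a ≠ a')
    (k : Fin ι ⊕ Fin ι) : GenericReal (Condition s S b) :=
  (etaReal hS hb a).add (gFamily hS hb hne k)

variable (hS : IsCute S) (hb : IsAmalgamationSequence S T c b) {a a' : Λ}

theorem not_fEq_etaReal (hne : a ≠ a') (p : Condition s S b) :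
    ¬ fEq (etaReal hS hb a).name (etaReal hS hb a').name p := by
  intro e
  obtain ⟨q, hpq, ha, ha', -⟩ := exists_le_mem hS hb p a a' 0
  obtain ⟨n, hn⟩ := Function.ne_iff.1
    ((hb.isBrick q.N).η_ne (q.mem_brick ha) (q.mem_brick ha') (q.injOn.ne ha ha' hne))
  exact GenericReal.not_fEq_name (x := etaReal hS hb a) (y := etaReal hS hb a') (n := n)
    ⟨ha, n.2, rfl⟩ ⟨ha', n.2, rfl⟩ hn (fEq_mono hpq e)

variable (hne : a ≠ a')

theorem fB_gReal (hT : ∀ m, IsTree (T m)) (i : Fin ι) (p : Condition s S b) :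
    fB T (gReal hS hb hne i).name p := by
  intro q _
  obtain ⟨r, hqr, ha, ha', -⟩ := exists_le_mem hS hb q a a' 0
  refine ⟨r, hqr, (b r.N).h i (r.φ a) (r.φ a'), GenericReal.fBranch_name fun t hrt n => ?_⟩
  obtain ⟨v, htv, hva, hva', hn⟩ := exists_le_mem hS hb t a a' n
  have hg := (hb.isBrick v.N).g_mem (v.mem_brick hva) (v.mem_brick hva') (v.injOn.ne hva hva' hne) i
  rw [(Extends.of_le (hrt.trans htv)).h_eq ha ha' hne i] at hg
  exact ⟨v, htv, _, hT _ _ _ (initSeg_restr hn _) hg, fun k => ⟨⟨hva, hva'⟩, k.2.trans_le hn,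
    ((initSeg_restr hn _).apply k.2 _)⟩⟩

theorem fB_gFamily (hT : ∀ m, IsTree (T m)) (k : Fin ι ⊕ Fin ι) (p : Condition s S b) :
    fB T (gFamily hS hb hne k).name p := by
  rcases k with i | i
  · exact fB_gReal hS hb hne hT i p
  · exact fB_gReal hS hb hne.symm hT i p

theorem fAdd_zFamily (k : Fin ι ⊕ Fin ι) (p : Condition s S b) :
    fAdd (etaReal hS hb a).name (gFamily hS hb hne k).name (zFamily hS hb hne k).name p :=
  GenericReal.fAdd_name (z := zFamily hS hb hne k)
    (fun p _ i j hi hj => ⟨p, le_rfl, i, j, hi, hj, rfl⟩) p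

/-- As `η_a + g_i(a, a') = η_{a'} + g_i(a', a)` in a group of exponent `2`, also
`η_a + g_i(a', a) = η_{a'} + g_i(a, a')`. -/
theorem fAdd_zFamily_swap (k : Fin ι ⊕ Fin ι) (p : Condition s S b) :
    fAdd (etaReal hS hb a').name (gFamily hS hb hne k.swap).name (zFamily hS hb hne k).name p := by
  have hadd : ∀ (p : Condition s S b) (ha : a ∈ p.w) (ha' : a' ∈ p.w) (i : Fin ι)
      (n : Fin (b p.N).n), (b p.N).η (p.φ a) n + (b p.N).g i (p.φ a) (p.φ a') n =
        (b p.N).η (p.φ a') n + (b p.N).g i (p.φ a') (p.φ a) n := fun p ha ha' i n =>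
    congrFun ((hb.isBrick p.N).add_eq (p.mem_brick ha) (p.mem_brick ha') (p.injOn.ne ha ha' hne) i)
      n
  have hswap : ∀ x y g g' : ZMod 2, x + g = y + g' → x + g' = y + g := by decide
  refine GenericReal.fAdd_name (fun p n i j hi hj => ⟨p, le_rfl, ?_⟩) p
  obtain ⟨ha', hn, rfl⟩ := hi
  rcases k with k | k
  · obtain ⟨⟨-, ha⟩, -, rfl⟩ := hj
    exact ⟨_, _, ⟨ha, hn, rfl⟩, ⟨⟨ha, ha'⟩, hn, rfl⟩, hadd p ha ha' k ⟨n, hn⟩⟩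
  · obtain ⟨⟨ha, -⟩, -, rfl⟩ := hj
    exact ⟨_, _, ⟨ha, hn, rfl⟩, ⟨⟨ha', ha⟩, hn, rfl⟩, hswap _ _ _ _ (hadd p ha ha' k ⟨n, hn⟩)⟩

theorem gFamily_val {p : Condition s S b} (ha : a ∈ p.w) (ha' : a' ∈ p.w) (k : Fin ι ⊕ Fin ι)
    (n : Fin (b p.N).n) : (gFamily hS hb hne k).val p n
      (Sum.elim (fun i => (b p.N).g i (p.φ a) (p.φ a'))
        (fun i => (b p.N).g i (p.φ a') (p.φ a)) k n) := by
  rcases k with i | i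
  · exact ⟨⟨ha, ha'⟩, n.2, rfl⟩
  · exact ⟨⟨ha', ha⟩, n.2, rfl⟩

theorem not_fEq_zFamily {k k' : Fin ι ⊕ Fin ι} (hk : k ≠ k') (p : Condition s S b) :
    ¬ fEq (zFamily hS hb hne k).name (zFamily hS hb hne k').name p := by
  intro e
  obtain ⟨q, hpq, ha, ha', -⟩ := exists_le_mem hS hb p a a' 0
  obtain ⟨n, hn⟩ := Function.ne_iff.1 (((hb.isBrick q.N).g_injective (q.mem_brick ha)
    (q.mem_brick ha') (q.injOn.ne ha ha' hne)).ne hk)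
  exact GenericReal.not_fEq_name (x := zFamily hS hb hne k) (y := zFamily hS hb hne k')
    ⟨_, _, ⟨ha, n.2, rfl⟩, gFamily_val hS hb hne ha ha' k n, rfl⟩
    ⟨_, _, ⟨ha, n.2, rfl⟩, gFamily_val hS hb hne ha ha' k' n, rfl⟩
    (fun h => hn (add_left_cancel h)) (fEq_mono hpq e)

theorem fOverlap_of_zFamily {σ τ : PName (Condition s S b)} {p : Condition s S b}
    (hσ : ∀ k q, p ≤ q → fTranslate T σ (zFamily hS hb hne k).name q)
    (hτ : ∀ k q, p ≤ q → fTranslate T τ (zFamily hS hb hne k).name q) :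
    fOverlap T (2 * ι) σ τ p := by
  let e : Fin (2 * ι) ≃ Fin ι ⊕ Fin ι := (finCongr (two_mul ι)).trans finSumFinEquiv.symm
  exact fun q hpq => ⟨q, le_rfl, fun i => (zFamily hS hb hne (e i)).name,
    fun i => ⟨hσ _ q hpq, hτ _ q hpq⟩,
    fun ij r _ => not_fEq_zFamily hS hb hne (e.injective.ne ij.2) r⟩

/-- Any two of the generic reals have a large overlap; for two equal ones the overlap with
another one is used. -/
theorem fOverlap_etaReal [Nontrivial Λ] (hT : ∀ m, IsTree (T m)) (a a' : Λ) (p : Condition s S b)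
    {σ τ : PName (Condition s S b)} (hσ : fEq σ (etaReal hS hb a).name p)
    (hτ : fEq τ (etaReal hS hb a').name p) : fOverlap T (2 * ι) σ τ p := by
  have key : ∀ {a a' : Λ} (hne : a ≠ a') {σ : PName (Condition s S b)},
      fEq σ (etaReal hS hb a).name p →
        ∀ k q, p ≤ q → fTranslate T σ (zFamily hS hb hne k).name q :=
    fun hne _ h k q hpq => GenericReal.fTranslate_name (fEq_mono hpq h)
      (fB_gFamily hS hb hne hT k q) (fAdd_zFamily hS hb hne k q)
  rcases eq_or_ne a a' with rfl | hne
  · obtain ⟨a', hne⟩ := exists_ne a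
    exact fOverlap_of_zFamily hS hb hne.symm (key hne.symm hσ) (key hne.symm hτ)
  · exact fOverlap_of_zFamily hS hb hne (key hne hσ) fun k q hpq =>
      GenericReal.fTranslate_name (fEq_mono hpq hτ) (fB_gFamily hS hb hne hT k.swap q)
        (fAdd_zFamily_swap hS hb hne k q)

end Condition

end Generic

end YZRForcing

open YZRForcing
theorem mainTheorem3 (ι : ℕ) (hι : 2 ≤ ι) (c : ℕ → ℕ) (T : ℕ → NodeSet)
    (hT : ∀ m, IsTree (T m)) (hT' : ∀ m, NoMaximalNodes (T m))
    (ε : Ordinal.{u}) (hε : 0 < ε) (hε' : ε < ω₁)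
    (S : YZRSystem ℕ ε) (hS : IsCute S) (hTS : ControlledAmalgamation S ι T c)
    (κ : Cardinal.{u}) (hκ : ℵ₀ ≤ κ) (hN : NPr ε κ) :
    ∃ (P : Type u) (_ : PartialOrder P), #P = κ ∧ IsCCC P ∧ IsKnaster P ∧
      Forced (fManyOverlaps (P := P) κ T (2 * ι)) := by
  obtain ⟨L, hL, hstr, hrank⟩ := hN
  obtain ⟨b, hb⟩ := hTS.exists_sequence
  have hinf : Infinite κ.ord.ToType := Cardinal.infinite_iff.2 (by rwa [Cardinal.mk_ord_toType])
  obtain ⟨s⟩ := nonempty_yzrSystem hε hrank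
  have hK : IsKnaster (Condition s S b) := Condition.isKnaster hS hb
  refine ⟨Condition s S b, inferInstance, ?_, hK.isCCC, hK, ?_⟩
  · rw [Condition.mk_eq hS hb, Cardinal.mk_ord_toType]
  · exact forced_fManyOverlaps (fun a => Condition.etaReal hS hb a)
      (fun a a' hne p => Condition.not_fEq_etaReal hS hb hne p)
      fun a a' p σ τ => Condition.fOverlap_etaReal hS hb hT a a' p
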